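/- Let $X$ be a metric space with Borel $\sigma$-algebra and let $\sigma$ be a finite diffuse Borel measure on $X$ (that is, $\sigma(\{x\})=0$ for all $x$). Let $\Omega$ be the space of configurations on $X$, i.e. of Radon measures $\omega=\sum_i\delta_{x_i}$ with at most countably many, pairwise distinct points $x_i$ (identified with the sets $\{x_1,x_2,\dots\}$), with the $\sigma$-algebra generated by the maps $\omega\mapsto\omega(B)$, $B$ Borel, and let $\pi$ be the Poisson measure with intensity $\sigma$ on $\Omega$, with expectation $E$. For $F:\Omega\to\mathbb R$ put $D_xF(\omega)=F(\omega)-F(\omega+\delta_x)$ if $x\notin\omega$ and $D_xF(\omega)=F(\omega)-F(\omega-\delta_x)$ if $x\in\omega$, and let $D_x^+F=\max(0,D_xF)$, $D_x^-F=-\min(0,D_xF)$. Write $|\cdot|_\infty$ for the (random) norm of $L^\infty(X,\frac{\sigma+\omega}{2})$ in the variable $x$. Define $$h_\infty^\pm=\inf_{0<\pi(A)<1/2}\frac{E[\,|D^\pm 1_A|_\infty]}{\pi(A)},\qquad k_\infty^\pm=\inf_{F}\frac{E[\,|D^\pm F|_\infty]}{E[(F-m(F))^+]},\qquad \lambda_\infty=\inf_{F}\frac{E[\,|DF|_\infty^2]}{\mathrm{Var}\,F},$$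 where $A$ runs over measurable sets; in $k_\infty^\pm$, $F$ runs over the measurable functions with $0<E[(F-m(F))^+]<\infty$, $m(F)$ being the largest median of $F$; and in $\lambda_\infty$, $F$ runs over the measurable square-integrable functions that are not almost surely constant. (Infima are taken in $[0,\infty]$; if $\sigma=0$, they are over empty families, and $\inf\emptyset=\infty$, $1/0=\infty$.) Then $$k^+_\infty=h^+_\infty\le 2\sqrt{\lambda_\infty}=\frac{2}{\sqrt{\sigma(X)}}\qquad\text{and}\qquad k^-_\infty=h^-_\infty\le\frac{2}{\sigma(X)}\Bigl(1+\sqrt{2\sigma(X)}\Bigr).$$ -/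

import Mathlib

open MeasureTheory
open scoped ENNReal Nat

noncomputable section

namespace PoissonSpace

/-- The configuration space over `X`: at most countable sets of points with finitely many points in
each compact set. A configuration `ω = {x₁, x₂, …}` is identified with the Radon measure
`∑ᵢ δ_{xᵢ}`, the points `xᵢ` being distinct. -/
def Configuration (X : Type*) [TopologicalSpace X] : Type _ :=
  {s : Set X // s.Countable ∧ ∀ K : Set X, IsCompact K → (s ∩ K).Finite}

namespace Configuration

variable {X : Type*} [TopologicalSpace X]

/-- The number `ω(B)` of points of the configuration `ω` in the set `B`. -/
def count (ω : Configuration X) (B : Set X) : ℕ∞ := (ω.1 ∩ B).encard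

/-- The configuration `ω + δ_x` (of interest for `x ∉ ω`). -/
def add (ω : Configuration X) (x : X) : Configuration X :=
  ⟨insert x ω.1, ω.2.1.insert x, fun K hK =>
    ((ω.2.2 K hK).insert x).subset (by
      rintro y ⟨hy | hy, hyK⟩
      · exact Or.inl hy
      · exact Or.inr ⟨hy, hyK⟩)⟩

/-- The configuration `ω - δ_x` (of interest for `x ∈ ω`). -/
def remove (ω : Configuration X) (x : X) : Configuration X :=
  ⟨ω.1 \ {x}, ω.2.1.mono Set.sdiff_subset, fun K hK =>
    (ω.2.2 K hK).subset (Set.inter_subset_inter_left K Set.sdiff_subset)⟩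

/-- The configuration as a measure on `X`: the sum of the Dirac masses at its points. -/
def toMeasure [MeasurableSpace X] (ω : Configuration X) : Measure X :=
  Measure.sum fun x : ω.1 => Measure.dirac (x : X)

/-- The `σ`-algebra generated by the maps `ω ↦ ω(B)`, `B` measurable. -/
instance [MeasurableSpace X] : MeasurableSpace (Configuration X) :=
  ⨆ (B : Set X) (_ : MeasurableSet B), MeasurableSpace.comap (fun ω => ω.count B) ⊤

end Configuration

variable {X : Type*} [TopologicalSpace X] [MeasurableSpace X]

/-- `π` is the Poisson measure with intensity `σ`: the numbers of points in disjoint measurable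
sets `A₁, …, Aₙ` are independent Poisson variables with parameters `σ(A₁), …, σ(Aₙ)`. -/
def IsPoissonMeasure (σ : Measure X) (π : Measure (Configuration X)) : Prop :=
  ∀ (n : ℕ) (A : Fin n → Set X) (k : Fin n → ℕ), (∀ i, MeasurableSet (A i)) →
    (Pairwise fun i j => Disjoint (A i) (A j)) →
    π {ω | ∀ i, ω.count (A i) = (k i : ℕ∞)} =
      ENNReal.ofReal (∏ i, σ.real (A i) ^ k i / (k i)! * Real.exp (-σ.real (A i)))

open Classical in
/-- The finite difference gradient `D_x F(ω)`. -/
def grad (F : Configuration X → ℝ) (ω : Configuration X) (x : X) : ℝ :=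
  if x ∈ ω.1 then F ω - F (ω.remove x) else F ω - F (ω.add x)

/-- `D_x⁺ F(ω) = max (0, D_x F(ω))`. -/
def gradPos (F : Configuration X → ℝ) (ω : Configuration X) (x : X) : ℝ :=
  max 0 (grad F ω x)

/-- `D_x⁻ F(ω) = - min (0, D_x F(ω))`. -/
def gradNeg (F : Configuration X → ℝ) (ω : Configuration X) (x : X) : ℝ :=
  -min 0 (grad F ω x)

/-- The norm of `u : X → ℝ` in `L^p((σ + ω)/2)`. -/
def symNorm (σ : Measure X) (p : ℝ≥0∞) (ω : Configuration X) (u : X → ℝ) : ℝ≥0∞ :=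
  eLpNorm u p ((2⁻¹ : ℝ≥0∞) • (σ + ω.toMeasure))

/-- `h_p⁺`, the infimum over measurable `A` with `0 < π(A) < 1/2` of `E[|D⁺1_A|_p] / π(A)`. -/
def hPos (σ : Measure X) (π : Measure (Configuration X)) (p : ℝ≥0∞) : ℝ≥0∞ :=
  ⨅ (A : Set (Configuration X)) (_ : MeasurableSet A) (_ : 0 < π A) (_ : π A < 2⁻¹),
    (∫⁻ ω, symNorm σ p ω (gradPos (A.indicator fun _ => 1) ω) ∂π) / π A

/-- `h_p⁻`, the infimum over measurable `A` with `0 < π(A) < 1/2` of `E[|D⁻1_A|_p] / π(A)`. -/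
def hNeg (σ : Measure X) (π : Measure (Configuration X)) (p : ℝ≥0∞) : ℝ≥0∞ :=
  ⨅ (A : Set (Configuration X)) (_ : MeasurableSet A) (_ : 0 < π A) (_ : π A < 2⁻¹),
    (∫⁻ ω, symNorm σ p ω (gradNeg (A.indicator fun _ => 1) ω) ∂π) / π A

/-- `m` is a median of `F`. -/
def IsMedian (π : Measure (Configuration X)) (F : Configuration X → ℝ) (m : ℝ) : Prop :=
  2⁻¹ ≤ π {ω | F ω ≤ m} ∧ 2⁻¹ ≤ π {ω | m ≤ F ω}

/-- The median `m(F)`. Medians form a nonempty compact interval; its right end is taken. -/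
def median (π : Measure (Configuration X)) (F : Configuration X → ℝ) : ℝ :=
  sSup {m | IsMedian π F m}

/-- The mean excess `E[(F - m(F))⁺]` of `F` over its median. -/
def excess (π : Measure (Configuration X)) (F : Configuration X → ℝ) : ℝ≥0∞ :=
  ∫⁻ ω, ENNReal.ofReal (max (F ω - median π F) 0) ∂π

/-- `k_p⁺`, the functional version of `h_p⁺`: the infimum of `E[|D⁺F|_p] / E[(F - m(F))⁺]` over
all measurable `F` for which the denominator is neither zero nor infinite. -/
def kPos (σ : Measure X) (π : Measure (Configuration X)) (p : ℝ≥0∞) : ℝ≥0∞ :=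
  ⨅ (F : Configuration X → ℝ) (_ : Measurable F) (_ : excess π F ≠ 0) (_ : excess π F ≠ ∞),
    (∫⁻ ω, symNorm σ p ω (gradPos F ω) ∂π) / excess π F

/-- `k_p⁻`, the functional version of `h_p⁻`: the infimum of `E[|D⁻F|_p] / E[(F - m(F))⁺]` over
all measurable `F` for which the denominator is neither zero nor infinite. -/
def kNeg (σ : Measure X) (π : Measure (Configuration X)) (p : ℝ≥0∞) : ℝ≥0∞ :=
  ⨅ (F : Configuration X → ℝ) (_ : Measurable F) (_ : excess π F ≠ 0) (_ : excess π F ≠ ∞),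
    (∫⁻ ω, symNorm σ p ω (gradNeg F ω) ∂π) / excess π F

/-- The Poincaré constant `λ_p`: the infimum of `E[|DF|_p²] / Var F` over all measurable square
integrable `F` which are not almost surely constant. -/
def poincareConst (σ : Measure X) (π : Measure (Configuration X)) (p : ℝ≥0∞) : ℝ≥0∞ :=
  ⨅ (F : Configuration X → ℝ) (_ : Measurable F) (_ : MemLp F 2 π)
    (_ : ProbabilityTheory.evariance F π ≠ 0),
    (∫⁻ ω, symNorm σ p ω (grad F ω) ^ 2 ∂π) / ProbabilityTheory.evariance F π

end PoissonSpace

end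

/-!
For the Poisson distribution on `ℕ` with mean `r`, Cauchy–Schwarz along the segment from `i` to `j`,
averaged over two independent copies `i`, `j`, gives the Poincaré inequality
`Var f ≤ r E |f(n + 1) - f(n)|²`. It tensorizes to functions of the numbers of points in finitely
many disjoint sets, and these are dense, so that
`Var F ≤ E ∫ |F(ω) - F(ω + δ_x)|² dσ(x) ≤ σ(X) E |DF|_∞²`. The number of points turns this into an
equality, whence `λ_∞ = 1 / σ(X)`.

The equalities `k_∞^± = h_∞^±` come from a co-area inequality: the levels `t` for which `1_{F > t}`
changes when a point is added or removed lie in an interval of length `|D^± F|_∞`. It is used for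
levels in an arithmetic progression above the median whose step tends to zero, so that no
measurability in `t` is needed.

For the upper bounds, let `N` be the number of points, `m` a median of its law, `d` the distance of
`N` to `{m - 1, m}`, and `g = d² + d`. The parts of `g` on the two sides of `{m - 1, m}` are each
positive with probability less than `1/2`, and together they give `h_∞^+ E[g] ≤ E[2d]` and
`h_∞^- E[g] ≤ E[2d + 2]`. Since `E[g] ≥ (E d)² + E d` by Jensen and `E[g] ≥ σ(X) - 1/4` by the
formula for the variance, `E d` can be eliminated. For `h_∞^-` and `σ(X) < log 2` the event `N > 0`
is used instead.
-/

noncomputable section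

namespace PoissonSpace

open ProbabilityTheory PoissonSpace.Configuration
open scoped NNReal

/-! ### The Poisson distribution on the natural numbers -/

theorem natCast_succ_mul_poissonMeasure_singleton (r : ℝ≥0) (n : ℕ) :
    ((n + 1 : ℕ) : ℝ≥0∞) * poissonMeasure r {n + 1} = r * poissonMeasure r {n} := by
  rw [poissonMeasure_singleton, poissonMeasure_singleton, ← ENNReal.ofReal_natCast,
    ← ENNReal.ofReal_coe_nnreal, ← ENNReal.ofReal_mul (by positivity),
    ← ENNReal.ofReal_mul (by positivity)]
  congr 1
  rw [Nat.factorial_succ, pow_succ]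
  push_cast
  field_simp

theorem lintegral_natCast_mul_poissonMeasure (r : ℝ≥0) (g : ℕ → ℝ≥0∞) :
    ∫⁻ n, n * g n ∂poissonMeasure r = r * ∫⁻ n, g (n + 1) ∂poissonMeasure r := by
  rw [lintegral_countable', lintegral_countable', tsum_eq_zero_add' ENNReal.summable,
    ← ENNReal.tsum_mul_left]
  simp only [Nat.cast_zero, zero_mul, zero_add]
  refine tsum_congr fun n => ?_
  rw [mul_right_comm, natCast_succ_mul_poissonMeasure_singleton]
  ring

theorem lintegral_natCast_poissonMeasure (r : ℝ≥0) :
    ∫⁻ n, (n : ℝ≥0∞) ∂poissonMeasure r = r := by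
  simpa using lintegral_natCast_mul_poissonMeasure r fun _ => 1

theorem setLIntegral_natCast_poissonMeasure (r : ℝ≥0) (S : Set ℕ) :
    ∫⁻ n in S, (n : ℝ≥0∞) ∂poissonMeasure r = r * poissonMeasure r {n | n + 1 ∈ S} := by
  have h := lintegral_natCast_mul_poissonMeasure r (S.indicator 1)
  rw [← lintegral_indicator .of_discrete, ← lintegral_indicator_one .of_discrete]
  convert h using 2
  · ext n
    by_cases hn : n ∈ S <;> simp [hn]
  · rfl

/-- The weight of `k` in the Cauchy–Schwarz bound for a difference along the segment from `i` to
`j`: the length `j - i` of the segment if it crosses the edge from `k` to `k + 1`. -/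
def crossing (k i j : ℕ) : ℝ≥0∞ := if i ≤ k ∧ k < j then (j - i : ℕ) else 0

theorem crossing_add (k i j : ℕ) :
    crossing k i j + (Set.Iic k).indicator (fun n => (n : ℝ≥0∞)) i * (Set.Ioi k).indicator 1 j =
      (Set.Iic k).indicator 1 i * (Set.Ioi k).indicator (fun n => (n : ℝ≥0∞)) j := by
  have hsub (hi : i ≤ k) (hj : k < j) : (j - i + i : ℝ≥0∞) = j :=
    tsub_add_cancel_of_le (by exact_mod_cast hi.trans hj.le)
  by_cases hi : i ≤ k <;> by_cases hj : k < j <;> simp [crossing, hi, hj, hsub]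

theorem lintegral_lintegral_crossing (r : ℝ≥0) (k : ℕ) :
    ∫⁻ i, ∫⁻ j, crossing k i j ∂poissonMeasure r ∂poissonMeasure r = r * poissonMeasure r {k} := by
  set μ := poissonMeasure r
  have hIic : μ (Set.Iic k) = μ (Set.Iio k) + μ {k} := by
    rw [← measure_union (by simp) .of_discrete, Set.Iio_union_right]
  have hIci : μ (Set.Ici k) = μ (Set.Ioi k) + μ {k} := by
    rw [← measure_union (by simp) .of_discrete, Set.union_comm, Set.singleton_union, Set.Ioi_insert]
  have htotal : μ (Set.Iio k) + (μ (Set.Ioi k) + μ {k}) = 1 := by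
    rw [← hIci, ← Set.compl_Iio, measure_add_measure_compl .of_discrete, measure_univ]
  have hsum : (∫⁻ i, ∫⁻ j, crossing k i j ∂μ ∂μ) + r * μ (Set.Iio k) * μ (Set.Ioi k) =
      μ (Set.Iic k) * (r * μ (Set.Ici k)) := by
    have h := congrArg (fun f : ℕ → ℕ → ℝ≥0∞ => ∫⁻ i, ∫⁻ j, f i j ∂μ ∂μ)
      (funext₂ (crossing_add k))
    simp only [lintegral_add_left Measurable.of_discrete,
      lintegral_const_mul _ Measurable.of_discrete, lintegral_mul_const _ Measurable.of_discrete,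
      lintegral_indicator_one MeasurableSet.of_discrete,
      lintegral_indicator MeasurableSet.of_discrete] at h
    rw [setLIntegral_natCast_poissonMeasure, setLIntegral_natCast_poissonMeasure] at h
    simp only [Set.mem_Iic, Set.mem_Ioi, Order.add_one_le_iff, Order.lt_add_one_iff] at h
    exact h
  have hfin : r * μ (Set.Iio k) * μ (Set.Ioi k) ≠ ∞ := by finiteness
  refine (ENNReal.add_left_inj hfin).1 ?_
  rw [hsum, hIic, hIci]
  calc (μ (Set.Iio k) + μ {k}) * (r * (μ (Set.Ioi k) + μ {k}))
      = r * μ {k} * (μ (Set.Iio k) + (μ (Set.Ioi k) + μ {k}))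
        + r * μ (Set.Iio k) * μ (Set.Ioi k) := by ring
    _ = r * μ {k} + r * μ (Set.Iio k) * μ (Set.Ioi k) := by rw [htotal, mul_one]

theorem enorm_sq_eq_ofReal (x : ℝ) : ‖x‖ₑ ^ 2 = ENNReal.ofReal (x ^ 2) := by
  rw [← enorm_pow, Real.enorm_of_nonneg (sq_nonneg x)]

theorem enorm_sub_sq_le_tsum_crossing (f : ℕ → ℝ) {i j : ℕ} (hij : i ≤ j) :
    ‖f i - f j‖ₑ ^ 2 ≤ ∑' k, ‖f (k + 1) - f k‖ₑ ^ 2 * crossing k i j := by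
  have hCS := sq_sum_le_card_mul_sum_sq (s := Finset.Ico i j) (f := fun k => f (k + 1) - f k)
  rw [Finset.sum_Ico_sub f hij, Nat.card_Ico, sub_sq_comm] at hCS
  calc ‖f i - f j‖ₑ ^ 2
      ≤ ENNReal.ofReal ((j - i : ℕ) * ∑ k ∈ Finset.Ico i j, (f (k + 1) - f k) ^ 2) := by
        rw [enorm_sq_eq_ofReal]; exact ENNReal.ofReal_le_ofReal hCS
    _ = ∑ k ∈ Finset.Ico i j, ‖f (k + 1) - f k‖ₑ ^ 2 * crossing k i j := by
        rw [ENNReal.ofReal_mul (by positivity), ENNReal.ofReal_natCast,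
          ENNReal.ofReal_sum_of_nonneg fun _ _ => sq_nonneg _, mul_comm, Finset.sum_mul]
        refine Finset.sum_congr rfl fun k hk => ?_
        rw [crossing, if_pos (Finset.mem_Ico.1 hk), enorm_sq_eq_ofReal]
    _ ≤ _ := ENNReal.sum_le_tsum _

theorem lintegral_lintegral_enorm_sub_sq_poissonMeasure_le (r : ℝ≥0) (f : ℕ → ℝ) :
    ∫⁻ i, ∫⁻ j, ‖f i - f j‖ₑ ^ 2 ∂poissonMeasure r ∂poissonMeasure r ≤
      2 * (r * ∫⁻ k, ‖f (k + 1) - f k‖ₑ ^ 2 ∂poissonMeasure r) := by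
  set μ := poissonMeasure r
  set w : ℕ → ℕ → ℝ≥0∞ := fun i j => ∑' k, ‖f (k + 1) - f k‖ₑ ^ 2 * crossing k i j with hw
  have hle (i j) : ‖f i - f j‖ₑ ^ 2 ≤ w i j + w j i := by
    rcases le_total i j with h | h
    · exact (enorm_sub_sq_le_tsum_crossing f h).trans le_self_add
    · rw [enorm_sub_rev]
      exact (enorm_sub_sq_le_tsum_crossing f h).trans le_add_self
  have hw_lintegral : ∫⁻ i, ∫⁻ j, w i j ∂μ ∂μ = r * ∫⁻ k, ‖f (k + 1) - f k‖ₑ ^ 2 ∂μ := by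
    simp only [hw, lintegral_tsum fun _ => Measurable.aemeasurable .of_discrete,
      lintegral_const_mul _ Measurable.of_discrete]
    rw [lintegral_countable', ← ENNReal.tsum_mul_left]
    refine tsum_congr fun k => ?_
    rw [lintegral_lintegral_crossing]
    ring
  have hw_swap : ∫⁻ i, ∫⁻ j, w j i ∂μ ∂μ = ∫⁻ i, ∫⁻ j, w i j ∂μ ∂μ :=
    lintegral_lintegral_swap (Measurable.aemeasurable .of_discrete)
  calc ∫⁻ i, ∫⁻ j, ‖f i - f j‖ₑ ^ 2 ∂μ ∂μ
      ≤ ∫⁻ i, ∫⁻ j, (w i j + w j i) ∂μ ∂μ :=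
        lintegral_mono fun i => lintegral_mono fun j => hle i j
    _ = (∫⁻ i, ∫⁻ j, w i j ∂μ ∂μ) + ∫⁻ i, ∫⁻ j, w j i ∂μ ∂μ := by
        simp only [lintegral_add_left Measurable.of_discrete]
    _ = 2 * (r * ∫⁻ k, ‖f (k + 1) - f k‖ₑ ^ 2 ∂μ) := by rw [hw_swap, hw_lintegral, two_mul]

section Tensorization

variable {α β : Type*} [MeasurableSpace α] [MeasurableSpace β] {μ : Measure α} {ν : Measure β}

theorem enorm_sub_sq_add_le_quadrilateral (a b c d : ℝ) :
    ‖a - d‖ₑ ^ 2 + ‖b - c‖ₑ ^ 2 ≤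
      (‖a - c‖ₑ ^ 2 + ‖b - d‖ₑ ^ 2) + (‖a - b‖ₑ ^ 2 + ‖c - d‖ₑ ^ 2) := by
  simp only [enorm_sq_eq_ofReal]
  repeat rw [← ENNReal.ofReal_add (by positivity) (by positivity)]
  exact ENNReal.ofReal_le_ofReal (by linarith [sq_nonneg (a - b - c + d)])

theorem two_mul_lintegral_lintegral_enorm_sub_sq_le [IsProbabilityMeasure ν] {u v : β → ℝ}
    (hu : Measurable u) (hv : Measurable v) :
    2 * ∫⁻ b, ∫⁻ b', ‖u b - v b'‖ₑ ^ 2 ∂ν ∂ν ≤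
      2 * ∫⁻ b, ‖u b - v b‖ₑ ^ 2 ∂ν +
        (∫⁻ b, ∫⁻ b', ‖u b - u b'‖ₑ ^ 2 ∂ν ∂ν + ∫⁻ b, ∫⁻ b', ‖v b - v b'‖ₑ ^ 2 ∂ν ∂ν) := by
  have hswap : ∫⁻ b, ∫⁻ b', ‖u b' - v b‖ₑ ^ 2 ∂ν ∂ν = ∫⁻ b, ∫⁻ b', ‖u b - v b'‖ₑ ^ 2 ∂ν ∂ν :=
    lintegral_lintegral_swap (by fun_prop)
  have h : ∫⁻ b, ∫⁻ b', (‖u b - v b'‖ₑ ^ 2 + ‖u b' - v b‖ₑ ^ 2) ∂ν ∂ν ≤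
      ∫⁻ b, ∫⁻ b', ((‖u b - v b‖ₑ ^ 2 + ‖u b' - v b'‖ₑ ^ 2) +
        (‖u b - u b'‖ₑ ^ 2 + ‖v b - v b'‖ₑ ^ 2)) ∂ν ∂ν :=
    lintegral_mono fun b => lintegral_mono fun b' =>
      enorm_sub_sq_add_le_quadrilateral (u b) (u b') (v b) (v b')
  simp (disch := fun_prop) only [lintegral_add_left, lintegral_const, measure_univ, mul_one] at h
  iterate 2 rw [lintegral_add_left (by fun_prop)] at h
  rwa [hswap, ← two_mul, ← two_mul] at h

theorem lintegral_lintegral_prod_enorm_sub_sq_le [IsProbabilityMeasure μ] [IsProbabilityMeasure ν]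
    {f : α × β → ℝ} (hf : Measurable f) :
    ∫⁻ p, ∫⁻ q, ‖f p - f q‖ₑ ^ 2 ∂μ.prod ν ∂μ.prod ν ≤
      ∫⁻ b, ∫⁻ a, ∫⁻ a', ‖f (a, b) - f (a', b)‖ₑ ^ 2 ∂μ ∂μ ∂ν +
        ∫⁻ a, ∫⁻ b, ∫⁻ b', ‖f (a, b) - f (a, b')‖ₑ ^ 2 ∂ν ∂ν ∂μ := by
  have hprod : ∫⁻ p, ∫⁻ q, ‖f p - f q‖ₑ ^ 2 ∂μ.prod ν ∂μ.prod ν =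
      ∫⁻ a, ∫⁻ a', ∫⁻ b, ∫⁻ b', ‖f (a, b) - f (a', b')‖ₑ ^ 2 ∂ν ∂ν ∂μ ∂μ := by
    rw [lintegral_prod _ (by fun_prop)]
    refine lintegral_congr fun a => ?_
    rw [lintegral_lintegral_swap (f := fun a' b => ∫⁻ b', ‖f (a, b) - f (a', b')‖ₑ ^ 2 ∂ν)
      (by fun_prop)]
    exact lintegral_congr fun b => lintegral_prod (fun q => ‖f (a, b) - f q‖ₑ ^ 2) (by fun_prop)
  have hfst : ∫⁻ b, ∫⁻ a, ∫⁻ a', ‖f (a, b) - f (a', b)‖ₑ ^ 2 ∂μ ∂μ ∂ν =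
      ∫⁻ a, ∫⁻ a', ∫⁻ b, ‖f (a, b) - f (a', b)‖ₑ ^ 2 ∂ν ∂μ ∂μ := by
    rw [lintegral_lintegral_swap (by fun_prop)]
    exact lintegral_congr fun a => lintegral_lintegral_swap (by fun_prop)
  have hinner (a : α) : 2 * ∫⁻ a', ∫⁻ b, ∫⁻ b', ‖f (a, b) - f (a', b')‖ₑ ^ 2 ∂ν ∂ν ∂μ ≤
      2 * ∫⁻ a', ∫⁻ b, ‖f (a, b) - f (a', b)‖ₑ ^ 2 ∂ν ∂μ +
        (∫⁻ b, ∫⁻ b', ‖f (a, b) - f (a, b')‖ₑ ^ 2 ∂ν ∂ν +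
          ∫⁻ a', ∫⁻ b, ∫⁻ b', ‖f (a', b) - f (a', b')‖ₑ ^ 2 ∂ν ∂ν ∂μ) := by
    have h := lintegral_mono (μ := μ) fun a' => two_mul_lintegral_lintegral_enorm_sub_sq_le (ν := ν)
      (u := fun b => f (a, b)) (v := fun b => f (a', b)) (by fun_prop) (by fun_prop)
    rwa [lintegral_const_mul _ (by fun_prop), lintegral_add_left (by fun_prop),
      lintegral_const_mul _ (by fun_prop), lintegral_add_left (by fun_prop), lintegral_const,
      measure_univ, mul_one] at h
  have h := lintegral_mono (μ := μ) hinner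
  rw [lintegral_const_mul _ (by fun_prop), lintegral_add_left (by fun_prop),
    lintegral_const_mul _ (by fun_prop), lintegral_add_left (by fun_prop), lintegral_const,
    measure_univ, mul_one, ← two_mul, ← mul_add] at h
  rw [hprod, hfst]
  exact (ENNReal.mul_le_mul_iff_right two_ne_zero ENNReal.ofNat_ne_top).1 h

end Tensorization

theorem lintegral_pi_fin_succ {α : Type*} [MeasurableSpace α] {n : ℕ}
    (μ : Fin (n + 1) → Measure α) [∀ i, SigmaFinite (μ i)] {g : (Fin (n + 1) → α) → ℝ≥0∞}
    (hg : Measurable g) :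
    ∫⁻ k, g k ∂Measure.pi μ =
      ∫⁻ p : α × (Fin n → α), g (Matrix.vecCons p.1 p.2)
        ∂(μ 0).prod (Measure.pi fun i => μ i.succ) := by
  rw [← (measurePreserving_piFinSuccAbove μ 0).symm.lintegral_comp hg]
  simp only [MeasurableEquiv.piFinSuccAbove_symm_apply, Fin.insertNthEquiv_zero]
  rfl

theorem vecCons_add_single_zero {M : Type*} [AddZeroClass M] {n : ℕ} (a e : M) (b : Fin n → M) :
    Matrix.vecCons a b + Pi.single 0 e = Matrix.vecCons (a + e) b := by
  ext i
  refine Fin.cases ?_ (fun i => ?_) i <;> simp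

theorem vecCons_add_single_succ {M : Type*} [AddZeroClass M] {n : ℕ} (a e : M) (b : Fin n → M)
    (i : Fin n) :
    Matrix.vecCons a b + Pi.single i.succ e = Matrix.vecCons a (b + Pi.single i e) := by
  ext j
  refine Fin.cases ?_ (fun j => ?_) j <;> simp [Pi.single_apply]

theorem lintegral_lintegral_enorm_sub_sq_pi_poissonMeasure_le {n : ℕ} (r : Fin n → ℝ≥0)
    (f : (Fin n → ℕ) → ℝ) :
    ∫⁻ k, ∫⁻ l, ‖f k - f l‖ₑ ^ 2 ∂Measure.pi (fun i => poissonMeasure (r i))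
        ∂Measure.pi (fun i => poissonMeasure (r i)) ≤
      2 * ∑ i, r i * ∫⁻ k, ‖f (k + Pi.single i 1) - f k‖ₑ ^ 2
        ∂Measure.pi fun i => poissonMeasure (r i) := by
  induction n with
  | zero =>
    have hf (k l : Fin 0 → ℕ) : f k = f l := congrArg f (Subsingleton.elim k l)
    simp [hf _ 0]
  | succ n ih =>
    let μ := poissonMeasure (r 0)
    let ν := Measure.pi fun i : Fin n => poissonMeasure (r i.succ)
    let g (p : ℕ × (Fin n → ℕ)) : ℝ := f (Matrix.vecCons p.1 p.2)
    simp only [lintegral_pi_fin_succ _ Measurable.of_discrete, Fin.sum_univ_succ,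
      vecCons_add_single_zero, vecCons_add_single_succ]
    calc ∫⁻ p, ∫⁻ q, ‖g p - g q‖ₑ ^ 2 ∂μ.prod ν ∂μ.prod ν
        ≤ ∫⁻ b, ∫⁻ a, ∫⁻ a', ‖g (a, b) - g (a', b)‖ₑ ^ 2 ∂μ ∂μ ∂ν +
          ∫⁻ a, ∫⁻ b, ∫⁻ b', ‖g (a, b) - g (a, b')‖ₑ ^ 2 ∂ν ∂ν ∂μ :=
          lintegral_lintegral_prod_enorm_sub_sq_le .of_discrete
      _ ≤ ∫⁻ b, 2 * (r 0 * ∫⁻ a, ‖g (a + 1, b) - g (a, b)‖ₑ ^ 2 ∂μ) ∂ν +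
          ∫⁻ a, 2 * ∑ i : Fin n, r i.succ *
            ∫⁻ b, ‖g (a, b + Pi.single i 1) - g (a, b)‖ₑ ^ 2 ∂ν ∂μ := by
          gcongr with b a
          · exact lintegral_lintegral_enorm_sub_sq_poissonMeasure_le (r 0) fun a => g (a, b)
          · exact ih (fun i => r i.succ) fun b => g (a, b)
      _ = 2 * (r 0 * ∫⁻ p, ‖g (p.1 + 1, p.2) - g p‖ₑ ^ 2 ∂μ.prod ν +
          ∑ i : Fin n, r i.succ *
            ∫⁻ p, ‖g (p.1, p.2 + Pi.single i 1) - g p‖ₑ ^ 2 ∂μ.prod ν) := by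
          simp only [lintegral_const_mul _ Measurable.of_discrete,
            lintegral_finsetSum _ fun _ _ => Measurable.of_discrete, mul_add]
          rw [lintegral_prod_symm _ (Measurable.aemeasurable .of_discrete)]
          simp only [lintegral_prod _ (Measurable.aemeasurable .of_discrete)]

/-! ### Configurations and numbers of points -/

theorem exists_common_refinement {X : Type*} [MeasurableSpace X] {n m : ℕ} {c : X → Fin n}
    {d : X → Fin m} (hc : Measurable c) (hd : Measurable d) :
    ∃ (e : X → Fin (n * m)) (p : Fin (n * m) → Fin n) (q : Fin (n * m) → Fin m),
      Measurable e ∧ c = p ∘ e ∧ d = q ∘ e := by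
  refine ⟨fun x => finProdFinEquiv (c x, d x), fun i => (finProdFinEquiv.symm i).1,
    fun i => (finProdFinEquiv.symm i).2, ?_, ?_, ?_⟩
  · exact (Measurable.of_discrete (f := finProdFinEquiv)).comp (hc.prodMk hd)
  · ext1 x; simp [- finProdFinEquiv_symm_apply]
  · ext1 x; simp [- finProdFinEquiv_symm_apply]

namespace Configuration

section Topological

variable {X : Type*} [TopologicalSpace X]

theorem count_add_of_mem {ω : Configuration X} {x : X} (hx : x ∉ ω.1) {B : Set X} (hB : x ∈ B) :
    (ω.add x).count B = ω.count B + 1 := by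
  rw [count, count, add, Set.insert_inter_of_mem hB,
    Set.encard_insert_of_notMem fun h => hx h.1]

theorem count_add_of_notMem (ω : Configuration X) {x : X} {B : Set X} (hB : x ∉ B) :
    (ω.add x).count B = ω.count B := by
  rw [count, count, add, Set.insert_inter_of_notMem hB]

theorem add_eq_self {ω : Configuration X} {x : X} (hx : x ∈ ω.1) : ω.add x = ω :=
  Subtype.ext (Set.insert_eq_of_mem hx)

theorem notMem_remove (ω : Configuration X) (x : X) : x ∉ (ω.remove x).1 := by
  simp [remove]

theorem add_remove {ω : Configuration X} {x : X} (hx : x ∈ ω.1) : (ω.remove x).add x = ω :=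
  Subtype.ext (by simp [remove, add, Set.insert_eq_of_mem hx])

/-- The numbers of points of each colour, where the finite partition of `X` into measurable sets
is encoded by a colouring `c`. -/
def counts {n : ℕ} (c : X → Fin n) (ω : Configuration X) (i : Fin n) : ℕ∞ := ω.count (c ⁻¹' {i})

theorem counts_add {n : ℕ} (c : X → Fin n) {ω : Configuration X} {x : X} (hx : x ∉ ω.1) :
    counts c (ω.add x) = counts c ω + Pi.single (c x) 1 := by
  ext1 i
  by_cases h : i = c x
  · subst h
    simp [counts, count_add_of_mem hx (B := c ⁻¹' {c x}) rfl]
  · simp [counts, h, count_add_of_notMem ω (B := c ⁻¹' {i}) (x := x) fun h' => h h'.symm]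

theorem count_preimage {n : ℕ} (c : X → Fin n) (T : Finset (Fin n)) (ω : Configuration X) :
    ω.count (c ⁻¹' (T : Set (Fin n))) = ∑ i ∈ T, counts c ω i := by
  have hdisj : (T : Set (Fin n)).PairwiseDisjoint fun i => ω.1 ∩ c ⁻¹' {i} := by
    intro i _ j _ hij
    refine Set.disjoint_left.2 ?_
    rintro x ⟨-, rfl⟩ ⟨-, h⟩
    exact hij h
  have hunion : ω.1 ∩ c ⁻¹' T = ⋃ i ∈ (T : Set (Fin n)), ω.1 ∩ c ⁻¹' {i} := by
    ext x
    simp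
  rw [count, hunion, T.finite_toSet.encard_biUnion hdisj, finsum_mem_coe_finset]
  rfl

theorem counts_comp {n m : ℕ} (p : Fin m → Fin n) (c : X → Fin m) (ω : Configuration X) :
    counts (p ∘ c) ω = fun i => ∑ j ∈ Finset.univ.filter (p · = i), counts c ω j := by
  ext1 i
  rw [← count_preimage, counts]
  congr 1
  ext x
  simp

end Topological

section Measurable

variable {X : Type*} [TopologicalSpace X] [MeasurableSpace X]

theorem measurable_count {B : Set X} (hB : MeasurableSet B) :
    Measurable fun ω : Configuration X => ω.count B :=
  Measurable.of_comap_le (le_iSup₂_of_le B hB le_rfl)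

theorem measurable_of_count {α : Type*} [MeasurableSpace α] {f : α → Configuration X}
    (hf : ∀ B, MeasurableSet B → Measurable fun a => (f a).count B) : Measurable f := by
  rw [measurable_iff_comap_le]
  simp only [instMeasurableSpace, MeasurableSpace.comap_iSup, MeasurableSpace.comap_comp]
  exact iSup₂_le fun B hB => (hf B hB).comap_le

theorem measurable_counts {n : ℕ} {c : X → Fin n} (hc : Measurable c) : Measurable (counts c) :=
  measurable_pi_lambda _ fun _ => measurable_count (hc (measurableSet_singleton _))

variable (X) in
/-- The algebra of events that depend on the numbers of points of finitely many colours. -/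
def cylinders : Set (Set (Configuration X)) :=
  {A | ∃ (n : ℕ) (c : X → Fin n) (S : Set (Fin n → ℕ∞)), Measurable c ∧ A = counts c ⁻¹' S}

theorem isSetAlgebra_cylinders : IsSetAlgebra (cylinders X) where
  empty_mem := ⟨1, fun _ => 0, ∅, measurable_const, rfl⟩
  compl_mem := by
    rintro _ ⟨n, c, S, hc, rfl⟩
    exact ⟨n, c, Sᶜ, hc, rfl⟩
  union_mem := by
    rintro _ _ ⟨n, c, S, hc, rfl⟩ ⟨m, d, T, hd, rfl⟩
    obtain ⟨e, p, q, he, rfl, rfl⟩ := exists_common_refinement hc hd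
    refine ⟨_, e, {v | (fun i => ∑ j ∈ Finset.univ.filter (p · = i), v j) ∈ S ∨
      (fun i => ∑ j ∈ Finset.univ.filter (q · = i), v j) ∈ T}, he, ?_⟩
    ext ω
    simp [counts_comp]

open Classical in
theorem eq_generateFrom_cylinders :
    (inferInstance : MeasurableSpace (Configuration X)) =
      MeasurableSpace.generateFrom (cylinders X) := by
  refine le_antisymm (iSup₂_le fun B hB => ?_) (MeasurableSpace.generateFrom_le ?_)
  · rintro _ ⟨S, -, rfl⟩
    refine MeasurableSpace.measurableSet_generateFrom
      ⟨2, fun x => if x ∈ B then 1 else 0, {v | v 1 ∈ S},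
        Measurable.ite hB measurable_const measurable_const, ?_⟩
    ext ω
    have : (fun x => if x ∈ B then (1 : Fin 2) else 0) ⁻¹' {1} = B := by
      ext x; by_cases h : x ∈ B <;> simp [h]
    simp [counts, this]
  · rintro _ ⟨n, c, S, hc, rfl⟩
    exact measurable_counts hc .of_discrete

variable [MeasurableSingletonClass X]

theorem measurable_add (ω : Configuration X) : Measurable ω.add := by
  classical
  refine measurable_of_count fun B hB => ?_
  have : (fun x => (ω.add x).count B) =
      fun x => if x ∈ B \ ω.1 then ω.count B + 1 else ω.count B := by
    ext1 x
    by_cases hx : x ∈ ω.1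
    · simp [add_eq_self hx, hx]
    · by_cases hB : x ∈ B
      · simp [hx, hB, count_add_of_mem]
      · simp [hB, count_add_of_notMem]
  rw [this]
  exact Measurable.ite (hB.diff ω.2.1.measurableSet) measurable_const measurable_const

end Measurable

end Configuration

section Kernel

variable {X : Type*} [TopologicalSpace X] [MeasurableSpace X] (σ : Measure X)

theorem lintegral_counts_add [NullSingletonClass σ] (ω : Configuration X) {n : ℕ} {c : X → Fin n}
    (hc : Measurable c) (f : (Fin n → ℕ∞) → ℝ≥0∞) :
    ∫⁻ x, f (counts c (ω.add x)) ∂σ =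
      ∑ i, σ (c ⁻¹' {i}) * f (counts c ω + Pi.single i 1) := by
  calc ∫⁻ x, f (counts c (ω.add x)) ∂σ
      = ∫⁻ x, f (counts c ω + Pi.single (c x) 1) ∂σ := by
        refine lintegral_congr_ae ?_
        filter_upwards [ω.2.1.ae_notMem σ] with x hx
        rw [counts_add c hx]
    _ = ∫⁻ i, f (counts c ω + Pi.single i 1) ∂σ.map c :=
        (lintegral_map (f := fun i => f (counts c ω + Pi.single i 1)) .of_discrete hc).symm
    _ = ∑ i, σ (c ⁻¹' {i}) * f (counts c ω + Pi.single i 1) := by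
        rw [lintegral_fintype]
        refine Finset.sum_congr rfl fun i _ => ?_
        rw [Measure.map_apply hc .of_discrete, mul_comm]

variable [MeasurableSingletonClass X] [IsFiniteMeasure σ] [NullSingletonClass σ]

/-- The kernel that adds to a configuration a point distributed according to `σ`. -/
def addKernel : Kernel (Configuration X) (Configuration X) where
  toFun ω := σ.map ω.add
  measurable' := by
    refine Measurable.measure_of_isPiSystem eq_generateFrom_cylinders
      isSetAlgebra_cylinders.isSetRing.isSetSemiring.isPiSystem ?_ ?_
    · rintro _ ⟨n, c, S, hc, rfl⟩
      have hS (ω : Configuration X) : σ.map ω.add (counts c ⁻¹' S) =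
          ∑ i, σ (c ⁻¹' {i}) * S.indicator 1 (counts c ω + Pi.single i 1) := by
        rw [← lintegral_counts_add σ ω hc, Measure.map_apply ω.measurable_add
          (measurable_counts hc .of_discrete), ← lintegral_indicator_one
          (ω.measurable_add (measurable_counts hc .of_discrete))]
        rfl
      simp only [hS]
      exact Finset.measurable_sum _ fun i _ => ((Measurable.of_discrete
        (f := S.indicator (1 : (Fin n → ℕ∞) → ℝ≥0∞))).comp
          ((measurable_counts hc).add_const _)).const_mul _
    · simp [Measure.map_apply (measurable_add _)]

instance : IsFiniteKernel (addKernel σ) :=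
  ⟨σ Set.univ, measure_lt_top _ _, fun ω => by
    simp [addKernel, Measure.map_apply (measurable_add _)]⟩

theorem lintegral_addKernel (ω : Configuration X) {g : Configuration X → ℝ≥0∞}
    (hg : Measurable g) : ∫⁻ η, g η ∂addKernel σ ω = ∫⁻ x, g (ω.add x) ∂σ :=
  lintegral_map hg ω.measurable_add

end Kernel

section Law

variable {X : Type*} [TopologicalSpace X] [MeasurableSpace X]
  {σ : Measure X} {π : Measure (Configuration X)}

theorem IsPoissonMeasure.isProbabilityMeasure (hπ : IsPoissonMeasure σ π) :
    IsProbabilityMeasure π :=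
  ⟨by simpa using hπ 0 Fin.elim0 Fin.elim0 (by simp) (by intro i; exact i.elim0)⟩

/-- The joint law of the numbers of points of each colour, as natural numbers. -/
def countsLaw (σ : Measure X) {n : ℕ} (c : X → Fin n) : Measure (Fin n → ℕ) :=
  Measure.pi fun i => poissonMeasure (σ (c ⁻¹' {i})).toNNReal

instance {n : ℕ} (c : X → Fin n) : IsProbabilityMeasure (countsLaw σ c) := by
  unfold countsLaw; infer_instance

theorem IsPoissonMeasure.measure_counts_eq (hπ : IsPoissonMeasure σ π) {n : ℕ} {c : X → Fin n}
    (hc : Measurable c) (k : Fin n → ℕ) :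
    π (counts c ⁻¹' {fun i => (k i : ℕ∞)}) = countsLaw σ c {k} := by
  have hdisj : Pairwise fun i j => Disjoint (c ⁻¹' {i}) (c ⁻¹' {j}) := fun i j hij =>
    Disjoint.preimage c (Set.disjoint_singleton.2 hij)
  have hpre : counts c ⁻¹' {fun i => (k i : ℕ∞)} =
      {ω | ∀ i, ω.count (c ⁻¹' {i}) = (k i : ℕ∞)} := by
    ext ω
    simp [funext_iff, counts]
  rw [hpre, hπ n _ k (fun i => hc (measurableSet_singleton i)) hdisj, countsLaw,
    Measure.pi_singleton, ENNReal.ofReal_prod_of_nonneg fun i _ => by positivity]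
  refine Finset.prod_congr rfl fun i _ => ?_
  rw [poissonMeasure_singleton, measureReal_def, ENNReal.coe_toNNReal_eq_toReal]
  congr 1
  ring

theorem IsPoissonMeasure.map_counts (hπ : IsPoissonMeasure σ π) {n : ℕ} {c : X → Fin n}
    (hc : Measurable c) :
    π.map (counts c) = (countsLaw σ c).map fun k i => (k i : ℕ∞) := by
  have := hπ.isProbabilityMeasure
  have hcast : Measurable fun (k : Fin n → ℕ) i => (k i : ℕ∞) := .of_discrete
  have : IsProbabilityMeasure (π.map (counts c)) :=
    Measure.isProbabilityMeasure_map (measurable_counts hc).aemeasurable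
  have : IsProbabilityMeasure ((countsLaw σ c).map fun k i => (k i : ℕ∞)) :=
    Measure.isProbabilityMeasure_map hcast.aemeasurable
  refine (Measure.eq_of_le_of_measure_univ_eq ?_ (by simp)).symm
  refine Measure.le_iff.2 fun s _ => ?_
  rw [← Measure.tsum_indicator_apply_singleton _ s .of_discrete,
    ← Measure.tsum_indicator_apply_singleton _ s .of_discrete]
  refine ENNReal.tsum_le_tsum fun v => Set.indicator_le_indicator ?_
  rw [Measure.map_apply hcast .of_discrete, Measure.map_apply (measurable_counts hc) .of_discrete]
  by_cases hv : ∃ k : Fin n → ℕ, (fun i => (k i : ℕ∞)) = v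
  · obtain ⟨k, rfl⟩ := hv
    have hpre : (fun (k : Fin n → ℕ) i => (k i : ℕ∞)) ⁻¹' {fun i => (k i : ℕ∞)} = {k} := by
      ext l
      simp [funext_iff]
    rw [hpre, hπ.measure_counts_eq hc]
  · have hpre : (fun (k : Fin n → ℕ) i => (k i : ℕ∞)) ⁻¹' {v} = ∅ :=
      Set.eq_empty_of_forall_notMem fun k hk => hv ⟨k, hk⟩
    rw [hpre, measure_empty]
    exact zero_le

theorem IsPoissonMeasure.lintegral_counts (hπ : IsPoissonMeasure σ π) {n : ℕ} {c : X → Fin n}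
    (hc : Measurable c) (f : (Fin n → ℕ∞) → ℝ≥0∞) :
    ∫⁻ ω, f (counts c ω) ∂π = ∫⁻ k, f (fun i => (k i : ℕ∞)) ∂countsLaw σ c := by
  rw [← lintegral_map .of_discrete (measurable_counts hc), hπ.map_counts hc,
    lintegral_map .of_discrete .of_discrete]

end Law

/-! ### The Poincaré inequality -/

section Closure

variable {Ω : Type*} [MeasurableSpace Ω] {p : ℝ≥0∞} {F G : Ω → ℝ}

theorem eLpNorm_fst_sub_snd_le {ν : Measure Ω} {ρ : Measure (Ω × Ω)} (hp : 1 ≤ p)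
    (hF : Measurable F) (hfst : ρ.fst ≤ ν) (hsnd : ρ.snd ≤ ν) :
    eLpNorm (fun q => F q.1 - F q.2) p ρ ≤ 2 * eLpNorm F p ν := by
  calc eLpNorm (fun q => F q.1 - F q.2) p ρ
      ≤ eLpNorm (F ∘ Prod.fst) p ρ + eLpNorm (F ∘ Prod.snd) p ρ :=
        eLpNorm_sub_le (hF.comp measurable_fst).aestronglyMeasurable
          (hF.comp measurable_snd).aestronglyMeasurable hp
    _ = eLpNorm F p ρ.fst + eLpNorm F p ρ.snd := by
        rw [Measure.fst, Measure.snd, eLpNorm_map_measure hF.aestronglyMeasurable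
          measurable_fst.aemeasurable, eLpNorm_map_measure hF.aestronglyMeasurable
          measurable_snd.aemeasurable]
    _ ≤ 2 * eLpNorm F p ν := by
        rw [two_mul]
        gcongr

theorem eLpNorm_fst_sub_snd_le_add {ν : Measure Ω} {ρ : Measure (Ω × Ω)} (hp : 1 ≤ p)
    (hF : Measurable F) (hG : Measurable G) (hfst : ρ.fst ≤ ν) (hsnd : ρ.snd ≤ ν) :
    eLpNorm (fun q => F q.1 - F q.2) p ρ ≤
      eLpNorm (fun q => G q.1 - G q.2) p ρ + 2 * eLpNorm (F - G) p ν := by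
  have hdecomp : (fun q : Ω × Ω => F q.1 - F q.2) =
      (fun q => G q.1 - G q.2) + fun q => (F - G) q.1 - (F - G) q.2 := by
    ext q
    simp only [Pi.add_apply, Pi.sub_apply]
    ring
  rw [hdecomp]
  refine (eLpNorm_add_le (by fun_prop) (by fun_prop) hp).trans ?_
  gcongr
  exact eLpNorm_fst_sub_snd_le hp (hF.sub hG) hfst hsnd

theorem eLpNorm_fst_sub_snd_le_of_dense {ν : Measure Ω} {ρ ρ' : Measure (Ω × Ω)} (hp : 1 ≤ p)
    (hF : Measurable F) (hν : ρ.fst + ρ.snd + (ρ'.fst + ρ'.snd) ≤ ν)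
    (hdense : ∀ ε : ℝ≥0∞, ε ≠ 0 → ∃ G : Ω → ℝ, Measurable G ∧ eLpNorm (F - G) p ν ≤ ε ∧
      eLpNorm (fun q => G q.1 - G q.2) p ρ ≤ eLpNorm (fun q => G q.1 - G q.2) p ρ') :
    eLpNorm (fun q => F q.1 - F q.2) p ρ ≤ eLpNorm (fun q => F q.1 - F q.2) p ρ' := by
  refine ENNReal.le_of_forall_pos_le_add fun ε hε _ => ?_
  obtain ⟨G, hG, hFG, hle⟩ := hdense ((ε / 4 : ℝ≥0)) (by positivity)
  have hGF : eLpNorm (G - F) p ν ≤ (ε / 4 : ℝ≥0) := by rwa [eLpNorm_sub_comm]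
  have h₁ : ρ.fst ≤ ν := le_trans (le_trans (Measure.le_add_right le_rfl)
    (Measure.le_add_right le_rfl)) hν
  have h₂ : ρ.snd ≤ ν := le_trans (le_trans (Measure.le_add_left le_rfl)
    (Measure.le_add_right le_rfl)) hν
  have h₁' : ρ'.fst ≤ ν := le_trans (le_trans (Measure.le_add_right le_rfl)
    (Measure.le_add_left le_rfl)) hν
  have h₂' : ρ'.snd ≤ ν := le_trans (le_trans (Measure.le_add_left le_rfl)
    (Measure.le_add_left le_rfl)) hν
  calc eLpNorm (fun q => F q.1 - F q.2) p ρ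
      ≤ eLpNorm (fun q => G q.1 - G q.2) p ρ + 2 * eLpNorm (F - G) p ν :=
        eLpNorm_fst_sub_snd_le_add hp hF hG h₁ h₂
    _ ≤ eLpNorm (fun q => F q.1 - F q.2) p ρ' + 2 * eLpNorm (G - F) p ν +
          2 * eLpNorm (F - G) p ν := by
        gcongr
        exact hle.trans (eLpNorm_fst_sub_snd_le_add hp hG hF h₁' h₂')
    _ ≤ eLpNorm (fun q => F q.1 - F q.2) p ρ' + 2 * (ε / 4 : ℝ≥0) + 2 * (ε / 4 : ℝ≥0) := by
        gcongr
    _ = eLpNorm (fun q => F q.1 - F q.2) p ρ' + ε := by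
        rw [add_assoc]
        congr 1
        norm_cast
        ring

/-- Truncation of a real number at level `n`, which reduces inequalities between second moments to
bounded functions. -/
def clamp (n : ℕ) (t : ℝ) : ℝ := max (-n) (min t n)

theorem measurable_clamp (n : ℕ) : Measurable (clamp n) := by unfold clamp; fun_prop

theorem abs_clamp_le (n : ℕ) (t : ℝ) : |clamp n t| ≤ n :=
  abs_le.2 ⟨le_max_left _ _, max_le (by linarith [n.cast_nonneg (α := ℝ)]) (min_le_right _ _)⟩

theorem abs_clamp_sub_clamp_le (n : ℕ) (s t : ℝ) : |clamp n s - clamp n t| ≤ |s - t| :=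
  (abs_max_sub_max_le_max _ _ _ _).trans (max_le (by simp)
    ((abs_min_sub_min_le_max _ _ _ _).trans (by simp)))

theorem tendsto_clamp (t : ℝ) : Filter.Tendsto (clamp · t) Filter.atTop (nhds t) := by
  refine tendsto_const_nhds.congr' ?_
  filter_upwards [Filter.eventually_ge_atTop ⌈|t|⌉₊] with n hn
  have ht := abs_le.1 (Nat.ceil_le.1 hn)
  rw [clamp, min_eq_left ht.2, max_eq_right ht.1]

theorem lintegral_enorm_fst_sub_snd_sq_le_of_bounded {ρ ρ' : Measure (Ω × Ω)}
    (hbdd : ∀ G : Ω → ℝ, Measurable G → (∃ C : ℝ, ∀ x, |G x| ≤ C) →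
      ∫⁻ q, ‖G q.1 - G q.2‖ₑ ^ 2 ∂ρ ≤ ∫⁻ q, ‖G q.1 - G q.2‖ₑ ^ 2 ∂ρ') (hF : Measurable F) :
    ∫⁻ q, ‖F q.1 - F q.2‖ₑ ^ 2 ∂ρ ≤ ∫⁻ q, ‖F q.1 - F q.2‖ₑ ^ 2 ∂ρ' := by
  have hmeas (n : ℕ) : Measurable (clamp n ∘ F) := (measurable_clamp n).comp hF
  have hlim (q : Ω × Ω) : Filter.Tendsto
      (fun n => ‖(clamp n ∘ F) q.1 - (clamp n ∘ F) q.2‖ₑ ^ 2) Filter.atTop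
      (nhds (‖F q.1 - F q.2‖ₑ ^ 2)) :=
    ((ENNReal.continuous_pow 2).comp continuous_enorm).continuousAt.tendsto.comp
      ((tendsto_clamp _).sub (tendsto_clamp _))
  have hle (n : ℕ) : ∫⁻ q, ‖(clamp n ∘ F) q.1 - (clamp n ∘ F) q.2‖ₑ ^ 2 ∂ρ ≤
      ∫⁻ q, ‖F q.1 - F q.2‖ₑ ^ 2 ∂ρ' := by
    refine (hbdd _ (hmeas n) ⟨n, fun x => abs_clamp_le n _⟩).trans
      (lintegral_mono fun q => ?_)
    gcongr
    exact enorm_le_iff_norm_le.2 (abs_clamp_sub_clamp_le n _ _)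
  calc ∫⁻ q, ‖F q.1 - F q.2‖ₑ ^ 2 ∂ρ
      = ∫⁻ q, Filter.liminf
          (fun n => ‖(clamp n ∘ F) q.1 - (clamp n ∘ F) q.2‖ₑ ^ 2) Filter.atTop ∂ρ :=
        lintegral_congr fun q => (hlim q).liminf_eq.symm
    _ ≤ Filter.liminf (fun n => ∫⁻ q, ‖(clamp n ∘ F) q.1 - (clamp n ∘ F) q.2‖ₑ ^ 2 ∂ρ)
          Filter.atTop := lintegral_liminf_le fun n =>
          (((hmeas n).comp measurable_fst).sub ((hmeas n).comp measurable_snd)).enorm.pow_const 2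
    _ ≤ ∫⁻ q, ‖F q.1 - F q.2‖ₑ ^ 2 ∂ρ' :=
        Filter.liminf_le_of_le (by isBoundedDefault) fun b hb => by
          obtain ⟨n, hn⟩ := hb.exists
          exact hn.trans (hle n)

end Closure

section Density

variable {X : Type*} [TopologicalSpace X] [MeasurableSpace X] {F : Configuration X → ℝ}
  {p : ℝ≥0∞} {ν : Measure (Configuration X)}

theorem exists_eLpNorm_sub_comp_counts_le [IsFiniteMeasure ν] (hp : p ≠ ∞) (hF : MemLp F p ν)
    {ε : ℝ≥0∞} (hε : ε ≠ 0) :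
    ∃ (n : ℕ) (c : X → Fin n) (f : (Fin n → ℕ∞) → ℝ), Measurable c ∧
      eLpNorm (F - f ∘ counts c) p ν ≤ ε := by
  suffices ∃ G : Configuration X → ℝ, eLpNorm (F - G) p ν ≤ ε ∧
      ∃ (n : ℕ) (c : X → Fin n), Measurable c ∧ ∃ f : (Fin n → ℕ∞) → ℝ, G = f ∘ counts c by
    obtain ⟨G, hG, n, c, hc, f, rfl⟩ := this
    exact ⟨n, c, f, hc, hG⟩
  refine MemLp.induction_dense hp _ ?_ ?_ ?_ hF hε
  · intro a s hs _ ε hε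
    obtain ⟨η, hη, h⟩ := exists_eLpNorm_indicator_le (μ := ν) hp a hε
    obtain ⟨_, ⟨n, c, S, hc, rfl⟩, hS⟩ :=
      (Measure.MeasureDense.of_generateFrom_isSetAlgebra_finite ν isSetAlgebra_cylinders
        eq_generateFrom_cylinders).approx s hs (measure_ne_top _ _) η (by exact_mod_cast hη)
    refine ⟨_, ?_, n, c, hc, S.indicator fun _ => a, rfl⟩
    rw [show (S.indicator fun _ => a) ∘ counts c =
      (counts c ⁻¹' S : Set (Configuration X)).indicator fun _ => a from rfl,
      eLpNorm_indicator_sub_indicator, symmDiff_comm]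
    exact h _ (hS.le.trans (by simp))
  · rintro _ _ ⟨n, c, hc, f, rfl⟩ ⟨m, d, hd, g, rfl⟩
    obtain ⟨e, p, q, he, rfl, rfl⟩ := exists_common_refinement hc hd
    refine ⟨_, e, he, fun v => f (fun i => ∑ j ∈ Finset.univ.filter (p · = i), v j) +
      g (fun i => ∑ j ∈ Finset.univ.filter (q · = i), v j), ?_⟩
    ext ω
    simp [counts_comp]
  · rintro _ ⟨n, c, hc, f, rfl⟩
    exact ((Measurable.of_discrete (f := f)).comp (measurable_counts hc)).aestronglyMeasurable

end Density

section Poincare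

variable {X : Type*} [TopologicalSpace X] [MeasurableSpace X]
  {σ : Measure X} [IsFiniteMeasure σ] [NullSingletonClass σ]
  {π : Measure (Configuration X)} {F : Configuration X → ℝ}

theorem IsPoissonMeasure.lintegral_lintegral_enorm_sub_sq_counts_le (hπ : IsPoissonMeasure σ π)
    {n : ℕ} {c : X → Fin n} (hc : Measurable c) (f : (Fin n → ℕ∞) → ℝ) :
    ∫⁻ ω, ∫⁻ η, ‖f (counts c ω) - f (counts c η)‖ₑ ^ 2 ∂π ∂π ≤
      2 * ∫⁻ ω, ∫⁻ x, ‖f (counts c ω) - f (counts c (ω.add x))‖ₑ ^ 2 ∂σ ∂π := by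
  let r (i : Fin n) : ℝ≥0 := (σ (c ⁻¹' {i})).toNNReal
  let g (k : Fin n → ℕ) : ℝ := f fun i => (k i : ℕ∞)
  have hg (k : Fin n → ℕ) (i : Fin n) :
      f ((fun j => (k j : ℕ∞)) + Pi.single i 1) = g (k + Pi.single i 1) := by
    congr 1
    ext1 j
    by_cases h : j = i <;> simp [h]
  have hleft : ∫⁻ ω, ∫⁻ η, ‖f (counts c ω) - f (counts c η)‖ₑ ^ 2 ∂π ∂π =
      ∫⁻ k, ∫⁻ l, ‖g k - g l‖ₑ ^ 2 ∂countsLaw σ c ∂countsLaw σ c := by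
    have hinner (v : Fin n → ℕ∞) :=
      hπ.lintegral_counts hc fun w => ‖f v - f w‖ₑ ^ 2
    simp only [hinner]
    exact hπ.lintegral_counts hc
      fun v => ∫⁻ l, ‖f v - f fun i => (l i : ℕ∞)‖ₑ ^ 2 ∂countsLaw σ c
  have hright : ∫⁻ ω, ∫⁻ x, ‖f (counts c ω) - f (counts c (ω.add x))‖ₑ ^ 2 ∂σ ∂π =
      ∑ i, r i * ∫⁻ k, ‖g (k + Pi.single i 1) - g k‖ₑ ^ 2 ∂countsLaw σ c := by
    let E (v : Fin n → ℕ∞) : ℝ≥0∞ := ∑ i, r i * ‖f v - f (v + Pi.single i 1)‖ₑ ^ 2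
    have hE (ω : Configuration X) :
        ∫⁻ x, ‖f (counts c ω) - f (counts c (ω.add x))‖ₑ ^ 2 ∂σ = E (counts c ω) := by
      simp only [lintegral_counts_add σ ω hc fun w => ‖f (counts c ω) - f w‖ₑ ^ 2, E, r,
        ENNReal.coe_toNNReal (measure_ne_top σ _)]
    simp only [hE, hπ.lintegral_counts hc E, E, hg]
    rw [lintegral_finsetSum _ fun i _ => Measurable.of_discrete]
    refine Finset.sum_congr rfl fun i _ => ?_
    rw [lintegral_const_mul _ .of_discrete]
    simp only [g, enorm_sub_rev]
  rw [hleft, hright]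
  exact lintegral_lintegral_enorm_sub_sq_pi_poissonMeasure_le r g

variable [MeasurableSingletonClass X]

theorem lintegral_compProd_addKernel [SFinite π] {g : Configuration X × Configuration X → ℝ≥0∞}
    (hg : Measurable g) :
    ∫⁻ q, g q ∂(π ⊗ₘ addKernel σ) = ∫⁻ ω, ∫⁻ x, g (ω, ω.add x) ∂σ ∂π := by
  rw [Measure.lintegral_compProd hg]
  exact lintegral_congr fun ω => lintegral_addKernel σ ω (hg.comp measurable_prodMk_left)

theorem IsPoissonMeasure.lintegral_lintegral_enorm_sub_sq_le (hπ : IsPoissonMeasure σ π)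
    (hF : Measurable F) :
    ∫⁻ ω, ∫⁻ η, ‖F ω - F η‖ₑ ^ 2 ∂π ∂π ≤
      2 * ∫⁻ ω, ∫⁻ x, ‖F ω - F (ω.add x)‖ₑ ^ 2 ∂σ ∂π := by
  have := hπ.isProbabilityMeasure
  set ρ := π.prod π
  set ρ' := (2 : ℝ≥0) • (π ⊗ₘ addKernel σ)
  have hρ {G : Configuration X → ℝ} (hG : Measurable G) :
      ∫⁻ q, ‖G q.1 - G q.2‖ₑ ^ 2 ∂ρ = ∫⁻ ω, ∫⁻ η, ‖G ω - G η‖ₑ ^ 2 ∂π ∂π :=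
    lintegral_prod _ (by fun_prop)
  have hρ' {G : Configuration X → ℝ} (hG : Measurable G) : ∫⁻ q, ‖G q.1 - G q.2‖ₑ ^ 2 ∂ρ' =
      2 * ∫⁻ ω, ∫⁻ x, ‖G ω - G (ω.add x)‖ₑ ^ 2 ∂σ ∂π := by
    rw [lintegral_smul_measure, lintegral_compProd_addKernel (by fun_prop)]
    rfl
  have hnorm (G : Configuration X → ℝ) (τ : Measure (Configuration X × Configuration X)) :
      eLpNorm (fun q => G q.1 - G q.2) 2 τ ^ 2 = ∫⁻ q, ‖G q.1 - G q.2‖ₑ ^ 2 ∂τ := by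
    simpa using eLpNorm_nnreal_pow_eq_lintegral (p := 2) (μ := τ)
      (f := fun q => G q.1 - G q.2) two_ne_zero
  rw [← hρ hF, ← hρ' hF]
  refine lintegral_enorm_fst_sub_snd_sq_le_of_bounded (fun G hG ⟨C, hC⟩ => ?_) hF
  rw [← hnorm, ← hnorm, ENNReal.pow_le_pow_left_iff two_ne_zero]
  refine eLpNorm_fst_sub_snd_le_of_dense one_le_two hG le_rfl fun ε hε => ?_
  obtain ⟨n, c, f, hc, hf⟩ := exists_eLpNorm_sub_comp_counts_le (p := 2)
    (ν := ρ.fst + ρ.snd + (ρ'.fst + ρ'.snd)) (by simp)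
    (MemLp.of_bound hG.aestronglyMeasurable C (.of_forall hC)) hε
  have hfm : Measurable (f ∘ counts c) :=
    (Measurable.of_discrete (f := f)).comp (measurable_counts hc)
  refine ⟨_, hfm, hf, ?_⟩
  rw [← ENNReal.pow_le_pow_left_iff two_ne_zero, hnorm, hnorm, hρ hfm, hρ' hfm]
  exact hπ.lintegral_lintegral_enorm_sub_sq_counts_le hc f

theorem two_mul_evariance_eq {Ω : Type*} [MeasurableSpace Ω] {μ : Measure Ω}
    [IsProbabilityMeasure μ] {Y : Ω → ℝ} (hY : MemLp Y 2 μ) (hm : Measurable Y) :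
    2 * evariance Y μ = ∫⁻ x, ∫⁻ y, ‖Y x - Y y‖ₑ ^ 2 ∂μ ∂μ := by
  have hsum : MemLp (fun q : Ω × Ω => Y q.1 + (-Y) q.2) 2 (μ.prod μ) :=
    (hY.comp_fst μ).add (hY.neg.comp_snd μ)
  have hY₁ : MemLp (fun q : Ω × Ω => Y q.1) 2 (μ.prod μ) := hY.comp_fst μ
  have hY₂ : MemLp (fun q : Ω × Ω => (-Y) q.2) 2 (μ.prod μ) := hY.neg.comp_snd μ
  have hmean : ∫ q : Ω × Ω, (Y q.1 + (-Y) q.2) ∂μ.prod μ = 0 := by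
    rw [integral_add (hY₁.integrable one_le_two) (hY₂.integrable one_le_two),
      integral_fun_fst, integral_fun_snd]
    simp [integral_neg]
  have hvar : 2 * Var[Y; μ] = Var[fun q : Ω × Ω => Y q.1 + (-Y) q.2; μ.prod μ] := by
    rw [variance_add_prod hY hY.neg, variance_neg, two_mul]
  rw [← hY.ofReal_variance_eq, ← ENNReal.ofReal_ofNat 2, ← ENNReal.ofReal_mul zero_le_two, hvar,
    hsum.ofReal_variance_eq, evariance, hmean, lintegral_prod _ (by fun_prop)]
  simp [sub_eq_add_neg]

theorem IsPoissonMeasure.evariance_le (hπ : IsPoissonMeasure σ π) (hF : Measurable F)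
    (hF2 : MemLp F 2 π) :
    evariance F π ≤ ∫⁻ ω, ∫⁻ x, ‖F ω - F (ω.add x)‖ₑ ^ 2 ∂σ ∂π := by
  have := hπ.isProbabilityMeasure
  rw [← ENNReal.mul_le_mul_iff_right two_ne_zero ENNReal.ofNat_ne_top,
    two_mul_evariance_eq hF2 hF]
  exact hπ.lintegral_lintegral_enorm_sub_sq_le hF

end Poincare

/-! ### Medians -/

theorem exists_greatest_median (μ : Measure ℝ) [IsProbabilityMeasure μ] :
    ∃ m : ℝ, 2⁻¹ ≤ μ (Set.Iic m) ∧ 2⁻¹ ≤ μ (Set.Ici m) ∧ ∀ t, m < t → μ (Set.Ici t) < 2⁻¹ := by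
  have hhalf : (2⁻¹ : ℝ≥0∞) = ENNReal.ofReal 2⁻¹ := by
    rw [ENNReal.ofReal_inv_of_pos two_pos, ENNReal.ofReal_ofNat]
  have hIci (x : ℝ) : μ (Set.Ici x) = ENNReal.ofReal (1 - Function.leftLim (cdf μ) x) := by
    conv_lhs => rw [← measure_cdf μ]
    exact (cdf μ).measure_Ici (tendsto_cdf_atTop μ) x
  set T := {t | 2⁻¹ < cdf μ t}
  have hne : T.Nonempty :=
    ((tendsto_cdf_atTop μ).eventually_const_lt (by norm_num : (2⁻¹ : ℝ) < 1)).exists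
  obtain ⟨a, ha⟩ := ((tendsto_cdf_atBot μ).eventually_lt_const
    (by norm_num : (0 : ℝ) < 2⁻¹)).exists
  have hbdd : BddBelow T := ⟨a, fun t ht => (monotone_cdf μ).reflect_lt (ha.trans ht) |>.le⟩
  have habove (t : ℝ) (ht : sInf T < t) : 2⁻¹ < cdf μ t := by
    obtain ⟨s, hs, hst⟩ := exists_lt_of_csInf_lt hne ht
    exact lt_of_lt_of_le hs (monotone_cdf μ hst.le)
  have hbelow (t : ℝ) (ht : t < sInf T) : cdf μ t ≤ 2⁻¹ := not_lt.1 fun h =>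
    notMem_of_lt_csInf (s := T) ht hbdd h
  refine ⟨sInf T, ?_, ?_, fun t ht => ?_⟩
  · rw [hhalf, ← ofReal_cdf]
    refine ENNReal.ofReal_le_ofReal (ge_of_tendsto
      (((cdf μ).right_continuous (sInf T)).tendsto.mono_left
        (nhdsWithin_mono _ Set.Ioi_subset_Ici_self)) ?_)
    filter_upwards [self_mem_nhdsWithin] with t ht using (habove t ht).le
  · rw [hhalf, hIci]
    have : Function.leftLim (cdf μ) (sInf T) ≤ 2⁻¹ := by
      refine le_of_tendsto ((monotone_cdf μ).tendsto_leftLim (sInf T)) ?_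
      filter_upwards [self_mem_nhdsWithin] with t ht using hbelow t ht
    exact ENNReal.ofReal_le_ofReal (by linarith)
  · rw [hhalf, hIci]
    obtain ⟨s, hs, hst⟩ := exists_between ht
    have := (habove s hs).trans_le ((monotone_cdf μ).le_leftLim hst)
    exact (ENNReal.ofReal_lt_ofReal_iff (by norm_num)).2 (by linarith)

section Median

variable {X : Type*} [TopologicalSpace X] [MeasurableSpace X] {π : Measure (Configuration X)}
  {F : Configuration X → ℝ}

theorem median_eq_of_forall_lt {m : ℝ} (hm : IsMedian π F m)
    (h : ∀ t, m < t → π {ω | t ≤ F ω} < 2⁻¹) : median π F = m :=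
  IsGreatest.csSup_eq ⟨hm, fun t ht => not_lt.1 fun hmt => (h t hmt).not_ge ht.2⟩

variable [IsProbabilityMeasure π]

theorem measure_le_lt_half (hF : Measurable F) {t : ℝ} (ht : median π F < t) :
    π {ω | t ≤ F ω} < 2⁻¹ := by
  have := Measure.isProbabilityMeasure_map (μ := π) hF.aemeasurable
  obtain ⟨m, hIic, hIci, hlt⟩ := exists_greatest_median (π.map F)
  simp only [Measure.map_apply hF measurableSet_Iic, Measure.map_apply hF measurableSet_Ici]
    at hIic hIci hlt
  exact hlt t (median_eq_of_forall_lt ⟨hIic, hIci⟩ hlt ▸ ht)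

theorem median_eq_zero (h0 : ∀ ω, 0 ≤ F ω) (h : π {ω | 0 < F ω} < 2⁻¹) : median π F = 0 := by
  refine median_eq_of_forall_lt ⟨?_, by simp [h0]⟩ fun t ht =>
    lt_of_le_of_lt (measure_mono fun ω (hω : t ≤ F ω) => ht.trans_le hω) h
  by_contra! h'
  have hcover : (Set.univ : Set (Configuration X)) ⊆ {ω | 0 < F ω} ∪ {ω | F ω ≤ 0} :=
    fun ω _ => (lt_or_ge 0 (F ω))
  refine (lt_irrefl (1 : ℝ≥0∞)) ?_
  calc 1 = π Set.univ := measure_univ.symm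
    _ ≤ π {ω | 0 < F ω} + π {ω | F ω ≤ 0} := (measure_mono hcover).trans (measure_union_le _ _)
    _ < 2⁻¹ + 2⁻¹ := ENNReal.add_lt_add h h'
    _ = 1 := ENNReal.inv_two_add_inv_two

theorem excess_eq_lintegral (h0 : ∀ ω, 0 ≤ F ω) (h : π {ω | 0 < F ω} < 2⁻¹) :
    excess π F = ∫⁻ ω, ENNReal.ofReal (F ω) ∂π := by
  simp [excess, median_eq_zero h0 h, h0]

theorem excess_indicator {A : Set (Configuration X)} (hA : MeasurableSet A) (h : π A < 2⁻¹) :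
    excess π (A.indicator fun _ => 1) = π A := by
  have hpos : {ω | 0 < A.indicator (fun _ => (1 : ℝ)) ω} = A := by
    ext ω
    by_cases hω : ω ∈ A <;> simp [hω]
  rw [excess_eq_lintegral (Set.indicator_nonneg fun _ _ => zero_le_one) (by rwa [hpos]),
    ← lintegral_indicator_one hA]
  refine lintegral_congr fun ω => ?_
  by_cases hω : ω ∈ A <;> simp [hω]

end Median

/-! ### The co-area inequality -/

theorem ofReal_le_tsum_indicator_add (y : ℝ) {ε : ℝ} (hε : 0 < ε) :
    ENNReal.ofReal y ≤
      ∑' k : ℕ, ENNReal.ofReal ε * {z : ℝ | (k + 1) * ε < z}.indicator 1 y +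
        ENNReal.ofReal ε := by
  set n := ⌈y / ε⌉₊ - 1
  have hceil : (⌈y / ε⌉₊ : ℝ) ≤ n + 1 := by exact_mod_cast (by lia : ⌈y / ε⌉₊ ≤ n + 1)
  have hy : y ≤ n * ε + ε := by
    have := (div_le_iff₀ hε).1 ((Nat.le_ceil (y / ε)).trans hceil)
    linarith
  have hterm (k : ℕ) (hk : k ∈ Finset.range n) :
      ENNReal.ofReal ε * {z : ℝ | (k + 1) * ε < z}.indicator 1 y = ENNReal.ofReal ε := by
    have hk' : ((k + 1 : ℕ) : ℝ) < y / ε := Nat.lt_ceil.1 (by grind)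
    rw [lt_div_iff₀ hε, Nat.cast_succ] at hk'
    simp [hk']
  calc ENNReal.ofReal y
      ≤ ENNReal.ofReal (n * ε + ε) := ENNReal.ofReal_le_ofReal hy
    _ = n * ENNReal.ofReal ε + ENNReal.ofReal ε := by
        rw [ENNReal.ofReal_add (by positivity) hε.le, ENNReal.ofReal_mul (by positivity),
          ENNReal.ofReal_natCast]
    _ = ∑ k ∈ Finset.range n, ENNReal.ofReal ε * {z : ℝ | (k + 1) * ε < z}.indicator 1 y +
          ENNReal.ofReal ε := by
        rw [Finset.sum_congr rfl hterm]
        simp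
    _ ≤ _ := by
        gcongr
        exact ENNReal.sum_le_tsum _

theorem tsum_indicator_Icc_le (a u g : ℝ) {ε : ℝ} (hε : 0 ≤ ε) :
    ∑' k : ℕ, ENNReal.ofReal ε * (Set.Icc u (u + g)).indicator 1 (a + k * ε) ≤
      ENNReal.ofReal (g + ε) := by
  let t (k : ℕ) : ℝ := a + k * ε
  have ht : Monotone t := fun k l hkl => by simp only [t]; gcongr
  let K := {k | t k ∈ Set.Icc u (u + g)}
  have hlen (k : ℕ) : volume (Set.Ioc (t k) (t (k + 1))) = ENNReal.ofReal ε := by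
    rw [Real.volume_Ioc]
    congr 1
    simp only [t]
    push_cast
    ring
  calc ∑' k : ℕ, ENNReal.ofReal ε * (Set.Icc u (u + g)).indicator 1 (a + k * ε)
      = ∑' k : K, volume (Set.Ioc (t k) (t (k + 1))) := by
        rw [tsum_subtype K fun k => volume (Set.Ioc (t k) (t (k + 1)))]
        refine tsum_congr fun k => ?_
        rw [Set.indicator_apply, Set.indicator_apply, hlen, mul_ite, Pi.one_apply, mul_one,
          mul_zero]
        rfl
    _ = volume (⋃ k : K, Set.Ioc (t k) (t (k + 1))) :=
        (measure_iUnion (f := fun k : K => Set.Ioc (t k) (t (k + 1))) (fun k l hkl =>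
          ht.pairwise_disjoint_on_Ioc_succ (Subtype.coe_ne_coe.2 hkl))
          fun _ => measurableSet_Ioc).symm
    _ ≤ volume (Set.Icc u (u + g + ε)) := by
        refine measure_mono (Set.iUnion_subset fun ⟨k, hk⟩ x hx => ?_)
        have hstep : t (k + 1) = t k + ε := by simp only [t]; push_cast; ring
        exact ⟨hk.1.trans hx.1.le, by linarith [hx.2, hk.2]⟩
    _ = ENNReal.ofReal (g + ε) := by
        rw [Real.volume_Icc]
        congr 1
        ring

theorem sum_lintegral_le_lintegral_sum {α ι : Type*} [MeasurableSpace α] {μ : Measure α}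
    (s : Finset ι) (f : ι → α → ℝ≥0∞) : ∑ i ∈ s, ∫⁻ x, f i x ∂μ ≤ ∫⁻ x, ∑ i ∈ s, f i x ∂μ := by
  classical
  induction s using Finset.induction_on with
  | empty => simp
  | insert i s hi ih =>
    simp only [Finset.sum_insert hi]
    exact (add_le_add_right ih _).trans (le_lintegral_add _ _)

theorem tsum_lintegral_le_lintegral_tsum {α ι : Type*} [MeasurableSpace α] {μ : Measure α}
    (f : ι → α → ℝ≥0∞) : ∑' i, ∫⁻ x, f i x ∂μ ≤ ∫⁻ x, ∑' i, f i x ∂μ := by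
  rw [ENNReal.tsum_eq_iSup_sum]
  exact iSup_le fun s => (sum_lintegral_le_lintegral_sum s f).trans
    (lintegral_mono fun x => ENNReal.sum_le_tsum s)

/-- The property of the norm `N F ω` of a (one-sided) discrete gradient of `F` at `ω` on which the
co-area inequality rests: the levels `t` that are crossed when `ω` is moved lie in an interval of
length `N F ω`. -/
structure IsCoareaNorm {Ω : Type*} (N : (Ω → ℝ) → Ω → ℝ≥0∞) : Prop where
  indicator_le_one (A : Set Ω) (ω : Ω) : N (A.indicator fun _ => 1) ω ≤ 1
  exists_Icc (F : Ω → ℝ) (ω : Ω) : N F ω ≠ ∞ → ∃ u : ℝ, ∀ t,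
    N ({η | t < F η}.indicator fun _ => 1) ω ≠ 0 → t ∈ Set.Icc u (u + (N F ω).toReal)

theorem IsCoareaNorm.tsum_superlevel_le {Ω : Type*} {N : (Ω → ℝ) → Ω → ℝ≥0∞}
    (hN : IsCoareaNorm N) (F : Ω → ℝ) (ω : Ω) (a : ℝ) {ε : ℝ} (hε : 0 ≤ ε) :
    ∑' k : ℕ, ENNReal.ofReal ε * N ({η | a + k * ε < F η}.indicator fun _ => 1) ω ≤
      N F ω + ENNReal.ofReal ε := by
  by_cases hF : N F ω = ∞
  · simp [hF]
  obtain ⟨u, hu⟩ := hN.exists_Icc F ω hF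
  calc ∑' k : ℕ, ENNReal.ofReal ε * N ({η | a + k * ε < F η}.indicator fun _ => 1) ω
      ≤ ∑' k : ℕ, ENNReal.ofReal ε *
          (Set.Icc u (u + (N F ω).toReal)).indicator 1 (a + k * ε) := by
        gcongr with k
        by_cases hk : a + k * ε ∈ Set.Icc u (u + (N F ω).toReal)
        · simpa [hk] using hN.indicator_le_one _ ω
        · simp [not_imp_comm.1 (hu _) hk]
    _ ≤ ENNReal.ofReal ((N F ω).toReal + ε) := tsum_indicator_Icc_le _ _ _ hε
    _ = N F ω + ENNReal.ofReal ε := by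
        rw [ENNReal.ofReal_add ENNReal.toReal_nonneg hε, ENNReal.ofReal_toReal hF]

section Coarea

variable {X : Type*} [TopologicalSpace X] [MeasurableSpace X] {π : Measure (Configuration X)}
  {N : (Configuration X → ℝ) → Configuration X → ℝ≥0∞} {F : Configuration X → ℝ}

variable (π N) in
/-- The isoperimetric constant of the gradient norm `N`, of which `hPos` and `hNeg` are special
cases. -/
def isoConst : ℝ≥0∞ :=
  ⨅ (A : Set (Configuration X)) (_ : MeasurableSet A) (_ : 0 < π A) (_ : π A < 2⁻¹),
    (∫⁻ ω, N (A.indicator fun _ => 1) ω ∂π) / π A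

variable (π N) in
/-- The functional version of `isoConst`, of which `kPos` and `kNeg` are special cases. -/
def medianConst : ℝ≥0∞ :=
  ⨅ (F : Configuration X → ℝ) (_ : Measurable F) (_ : excess π F ≠ 0) (_ : excess π F ≠ ∞),
    (∫⁻ ω, N F ω ∂π) / excess π F

variable [IsProbabilityMeasure π]

theorem isoConst_mul_measure_le {A : Set (Configuration X)} (hA : MeasurableSet A)
    (h : π A < 2⁻¹) : isoConst π N * π A ≤ ∫⁻ ω, N (A.indicator fun _ => 1) ω ∂π := by
  rcases eq_or_ne (π A) 0 with h0 | h0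
  · simp [h0]
  rw [← ENNReal.le_div_iff_mul_le (.inl h0) (.inl (measure_ne_top _ _))]
  exact iInf₂_le_of_le A hA (iInf₂_le (pos_iff_ne_zero.2 h0) h)

theorem excess_le_tsum_measure_add (hF : Measurable F) {ε : ℝ} (hε : 0 < ε) :
    excess π F ≤ ∑' k : ℕ, ENNReal.ofReal ε * π {ω | median π F + ε + k * ε < F ω} +
      ENNReal.ofReal ε := by
  have hmeas (k : ℕ) : MeasurableSet {ω | median π F + ε + k * ε < F ω} :=
    measurableSet_lt measurable_const hF
  calc excess π F
      ≤ ∫⁻ ω, (∑' k : ℕ, ENNReal.ofReal ε *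
          {ω | median π F + ε + k * ε < F ω}.indicator 1 ω + ENNReal.ofReal ε) ∂π := by
        refine lintegral_mono fun ω => ?_
        rw [ENNReal.ofReal_max, ENNReal.ofReal_zero, max_eq_left zero_le]
        refine (ofReal_le_tsum_indicator_add (F ω - median π F) hε).trans (le_of_eq ?_)
        congr! 5 with k
        simp only [Set.indicator_apply, Set.mem_ofPred_eq, lt_sub_iff_add_lt, Pi.one_apply]
        congr! 2
        ring
    _ = _ := by
        rw [lintegral_add_right _ measurable_const, lintegral_tsum fun k =>
          ((measurable_one.indicator (hmeas k)).const_mul _).aemeasurable]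
        simp only [lintegral_const_mul _ (measurable_one.indicator (hmeas _)),
          lintegral_indicator_one (hmeas _), lintegral_const, measure_univ, mul_one]

theorem IsCoareaNorm.isoConst_mul_excess_le (hN : IsCoareaNorm N) (hF : Measurable F) :
    isoConst π N * excess π F ≤ ∫⁻ ω, N F ω ∂π := by
  refine ENNReal.mul_le_of_forall_lt fun a ha b hb => (mul_le_mul_right hb.le a).trans ?_
  lift a to ℝ≥0 using ha.ne_top
  refine ENNReal.le_of_forall_pos_le_add fun δ hδ _ => ?_
  let ε : ℝ≥0 := δ / (1 + a)
  have hε : (0 : ℝ) < ε := by positivity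
  let E (k : ℕ) : Set (Configuration X) := {ω | median π F + ε + k * ε < F ω}
  have hE (k : ℕ) : a * π (E k) ≤ ∫⁻ ω, N ((E k).indicator fun _ => 1) ω ∂π := by
    have hlt : median π F < median π F + ε + k * ε := by
      have : (0 : ℝ) ≤ k * ε := by positivity
      linarith
    refine (mul_le_mul_left ha.le _).trans
      (isoConst_mul_measure_le (measurableSet_lt measurable_const hF) ?_)
    exact (measure_mono fun ω (hω : _ < F ω) => hω.le).trans_lt (measure_le_lt_half hF hlt)
  calc (a : ℝ≥0∞) * excess π F
      ≤ a * (∑' k, ε * π (E k) + ε) := by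
        gcongr
        simpa only [ENNReal.ofReal_coe_nnreal] using excess_le_tsum_measure_add hF hε
    _ = ∑' k, ε * (a * π (E k)) + a * ε := by
        simp only [mul_add, ← ENNReal.tsum_mul_left, mul_left_comm]
    _ ≤ ∑' k, ∫⁻ ω, ε * N ((E k).indicator fun _ => 1) ω ∂π + a * ε := by
        gcongr with k
        rw [lintegral_const_mul' _ _ ENNReal.coe_ne_top]
        gcongr
        exact hE k
    _ ≤ ∫⁻ ω, ∑' k, ε * N ((E k).indicator fun _ => 1) ω ∂π + a * ε := by
        gcongr
        exact tsum_lintegral_le_lintegral_tsum _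
    _ ≤ ∫⁻ ω, (N F ω + ε) ∂π + a * ε := by
        gcongr with ω
        simpa only [ENNReal.ofReal_coe_nnreal] using
          hN.tsum_superlevel_le F ω (median π F + ε) hε.le
    _ = ∫⁻ ω, N F ω ∂π + (1 + a) * ε := by
        rw [lintegral_add_right _ measurable_const, lintegral_const, measure_univ, mul_one,
          add_assoc, add_mul, one_mul]
    _ = ∫⁻ ω, N F ω ∂π + δ := by
        congr 1
        norm_cast
        exact mul_div_cancel₀ δ (by positivity)

theorem IsCoareaNorm.medianConst_eq_isoConst (hN : IsCoareaNorm N) :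
    medianConst π N = isoConst π N := by
  refine le_antisymm (le_iInf₂ fun A hA => le_iInf₂ fun h0 h1 => ?_)
    (le_iInf₂ fun F hF => le_iInf₂ fun h0 h1 => ?_)
  · have hexcess := excess_indicator hA h1
    refine iInf₂_le_of_le (A.indicator fun _ => 1) (measurable_const.indicator hA)
      (iInf₂_le_of_le (hexcess ▸ h0.ne') (hexcess ▸ measure_ne_top _ _) ?_)
    rw [hexcess]
  · rw [ENNReal.le_div_iff_mul_le (.inl h0) (.inl h1)]
    exact hN.isoConst_mul_excess_le hF

end Coarea

section Gradient

variable {X : Type*} [TopologicalSpace X]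

open Classical in
/-- The configuration with the status of the point `x` changed: the move along which `grad` is the
difference. -/
def flip (ω : Configuration X) (x : X) : Configuration X :=
  if x ∈ ω.1 then ω.remove x else ω.add x

theorem grad_eq_sub_flip (F : Configuration X → ℝ) (ω : Configuration X) (x : X) :
    grad F ω x = F ω - F (flip ω x) := by
  unfold grad flip
  split_ifs <;> rfl

theorem gradNeg_eq_gradPos_neg (F : Configuration X → ℝ) (ω : Configuration X) :
    gradNeg F ω = gradPos (fun η => -F η) ω := by
  ext x
  rw [gradNeg, gradPos, grad_eq_sub_flip, grad_eq_sub_flip, ← max_neg_neg]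
  ring_nf

theorem gradPos_indicator (A : Set (Configuration X)) (ω : Configuration X) (x : X) :
    gradPos (A.indicator fun _ => 1) ω x =
      {x | ω ∈ A ∧ flip ω x ∉ A}.indicator (fun _ => 1) x := by
  rw [gradPos, grad_eq_sub_flip]
  by_cases h : ω ∈ A <;> by_cases h' : flip ω x ∈ A <;> simp [h, h']

theorem gradNeg_indicator (A : Set (Configuration X)) (ω : Configuration X) (x : X) :
    gradNeg (A.indicator fun _ => 1) ω x =
      {x | ω ∉ A ∧ flip ω x ∈ A}.indicator (fun _ => 1) x := by
  rw [gradNeg, grad_eq_sub_flip]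
  by_cases h : ω ∈ A <;> by_cases h' : flip ω x ∈ A <;> simp [h, h']

variable [MeasurableSpace X] {σ : Measure X} {ω : Configuration X}

theorem symNorm_top_le {u : X → ℝ} {b : ℝ} (h : ∀ x, |u x| ≤ b) :
    symNorm σ ∞ ω u ≤ ENNReal.ofReal b := by
  rw [symNorm, eLpNorm_exponent_top]
  exact eLpNormEssSup_le_of_ae_bound (.of_forall h)

theorem exists_ne_zero_and_abs_le_of_symNorm_top {u v : X → ℝ} (hu : symNorm σ ∞ ω u ≠ ∞)
    (hv : symNorm σ ∞ ω v ≠ 0) : ∃ x, v x ≠ 0 ∧ |u x| ≤ (symNorm σ ∞ ω u).toReal := by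
  simp only [symNorm, eLpNorm_exponent_top] at hu hv ⊢
  rw [Ne, eLpNormEssSup_eq_zero_iff] at hv
  obtain ⟨x, hvx, hux⟩ := ((Filter.not_eventually.1 hv).and_eventually
    (ae_le_eLpNormEssSup (f := u))).exists
  refine ⟨x, hvx, ?_⟩
  rwa [Real.enorm_eq_ofReal_abs, ENNReal.ofReal_le_iff_le_toReal hu] at hux

theorem symNorm_top_indicator_one_le (s : Set X) :
    symNorm σ ∞ ω (s.indicator fun _ => 1) ≤ 1 := by
  refine (symNorm_top_le (b := 1) fun x => ?_).trans (by simp)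
  by_cases hx : x ∈ s <;> simp [hx]

variable (σ) in
theorem isCoareaNorm_gradPos : IsCoareaNorm fun F ω => symNorm σ ∞ ω (gradPos F ω) where
  indicator_le_one A ω := by
    rw [funext (gradPos_indicator A ω)]
    exact symNorm_top_indicator_one_le _
  exists_Icc F ω hF := by
    refine ⟨F ω - (symNorm σ ∞ ω (gradPos F ω)).toReal, fun t ht => ?_⟩
    obtain ⟨x, hx, hle⟩ := exists_ne_zero_and_abs_le_of_symNorm_top hF ht
    rw [gradPos_indicator, Set.indicator_apply_ne_zero] at hx
    obtain ⟨⟨hω : t < F ω, hflip : ¬t < F (flip ω x)⟩, -⟩ := hx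
    have hgrad : F ω - F (flip ω x) ≤ gradPos F ω x := by
      rw [gradPos, grad_eq_sub_flip]
      exact le_max_right _ _
    constructor <;> linarith [le_abs_self (gradPos F ω x)]

variable (σ) in
theorem isCoareaNorm_gradNeg : IsCoareaNorm fun F ω => symNorm σ ∞ ω (gradNeg F ω) where
  indicator_le_one A ω := by
    rw [funext (gradNeg_indicator A ω)]
    exact symNorm_top_indicator_one_le _
  exists_Icc F ω hF := by
    refine ⟨F ω, fun t ht => ?_⟩
    obtain ⟨x, hx, hle⟩ := exists_ne_zero_and_abs_le_of_symNorm_top hF ht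
    rw [gradNeg_indicator, Set.indicator_apply_ne_zero] at hx
    obtain ⟨⟨hω : ¬t < F ω, hflip : t < F (flip ω x)⟩, -⟩ := hx
    have hgrad : F (flip ω x) - F ω ≤ gradNeg F ω x := by
      rw [gradNeg, grad_eq_sub_flip, ← neg_sub]
      exact neg_le_neg (min_le_right _ _)
    constructor <;> linarith [le_abs_self (gradNeg F ω x)]

theorem kPos_eq_hPos {π : Measure (Configuration X)} [IsProbabilityMeasure π] :
    kPos σ π ∞ = hPos σ π ∞ :=
  (isCoareaNorm_gradPos σ).medianConst_eq_isoConst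

theorem kNeg_eq_hNeg {π : Measure (Configuration X)} [IsProbabilityMeasure π] :
    kNeg σ π ∞ = hNeg σ π ∞ :=
  (isCoareaNorm_gradNeg σ).medianConst_eq_isoConst

end Gradient

/-! ### The number of points -/

section Moments

variable (r : ℝ≥0)

theorem lintegral_natCast_sq_poissonMeasure :
    ∫⁻ n, (n : ℝ≥0∞) ^ 2 ∂poissonMeasure r = r * (r + 1) := by
  simp only [sq, lintegral_natCast_mul_poissonMeasure, Nat.cast_add, Nat.cast_one,
    lintegral_add_right _ measurable_const, lintegral_natCast_poissonMeasure, lintegral_one,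
    measure_univ]

theorem memLp_natCast_poissonMeasure : MemLp (fun n : ℕ => (n : ℝ)) 2 (poissonMeasure r) := by
  rw [memLp_two_iff_integrable_sq .of_discrete]
  refine ⟨.of_discrete, ?_⟩
  simp only [HasFiniteIntegral, enorm_pow, Real.enorm_natCast, lintegral_natCast_sq_poissonMeasure]
  finiteness

theorem integral_natCast_poissonMeasure : ∫ n, (n : ℝ) ∂poissonMeasure r = r := by
  rw [integral_eq_lintegral_of_nonneg_ae (.of_forall fun n => by positivity) .of_discrete]
  simp [lintegral_natCast_poissonMeasure]

theorem integral_natCast_sq_poissonMeasure :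
    ∫ n, (n : ℝ) ^ 2 ∂poissonMeasure r = r * (r + 1) := by
  rw [integral_eq_lintegral_of_nonneg_ae (.of_forall fun n => by positivity) .of_discrete]
  simp only [ENNReal.ofReal_pow (Nat.cast_nonneg _), ENNReal.ofReal_natCast,
    lintegral_natCast_sq_poissonMeasure]
  norm_cast

theorem integral_sub_sq_poissonMeasure (a : ℝ) :
    ∫ n, ((n : ℝ) - a) ^ 2 ∂poissonMeasure r = r + (r - a) ^ 2 := by
  have h2 := (memLp_natCast_poissonMeasure r).integrable_sq
  have h1 : Integrable (fun n : ℕ => 2 * (n : ℝ) * a) (poissonMeasure r) :=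
    (((memLp_natCast_poissonMeasure r).integrable one_le_two).const_mul 2).mul_const a
  simp only [sub_sq]
  rw [integral_add (f := fun n : ℕ => (n : ℝ) ^ 2 - 2 * n * a) (h2.sub h1) (integrable_const _),
    integral_sub h2 h1, integral_mul_const, integral_const_mul, integral_natCast_poissonMeasure,
    integral_natCast_sq_poissonMeasure, integral_const, probReal_univ, one_smul]
  ring

theorem lintegral_enorm_sub_sq_poissonMeasure (a : ℝ) :
    ∫⁻ n : ℕ, ‖(n : ℝ) - a‖ₑ ^ 2 ∂poissonMeasure r = ENNReal.ofReal (r + (r - a) ^ 2) := by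
  simp only [enorm_sq_eq_ofReal]
  rw [← integral_sub_sq_poissonMeasure]
  exact (ofReal_integral_eq_lintegral_ofReal
    ((memLp_natCast_poissonMeasure r).sub (memLp_const a)).integrable_sq
    (.of_forall fun n => sq_nonneg _)).symm

end Moments

section Card

variable {X : Type*} [TopologicalSpace X]

/-- The number of points of a configuration, with the junk value `0` if it is infinite. It is the
extremal function for `poincareConst`. -/
def card (ω : Configuration X) : ℕ := (ω.count Set.univ).toNat

theorem card_flip {ω : Configuration X} (hω : ω.count Set.univ ≠ ⊤) (x : X) :
    card (flip ω x) = card ω + 1 ∨ card ω = card (flip ω x) + 1 := by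
  unfold flip card
  split_ifs with hx
  · right
    have h := count_add_of_mem (notMem_remove ω x) (Set.mem_univ x)
    rw [add_remove hx] at h
    have h' : (ω.remove x).count Set.univ ≠ ⊤ := fun h' => hω (by simp [h, h'])
    rw [h, ENat.toNat_add h' ENat.one_ne_top, ENat.toNat_one]
  · left
    rw [count_add_of_mem hx (Set.mem_univ x), ENat.toNat_add hω ENat.one_ne_top, ENat.toNat_one]

variable [MeasurableSpace X] {σ : Measure X} {π : Measure (Configuration X)}

theorem symNorm_grad_card_le {ω : Configuration X} (hω : ω.count Set.univ ≠ ⊤) :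
    symNorm σ ∞ ω (grad (fun η => (card η : ℝ)) ω) ≤ 1 := by
  refine (symNorm_top_le (b := 1) fun x => ?_).trans (by simp)
  rw [grad_eq_sub_flip]
  rcases card_flip hω x with h | h <;> simp [h]

theorem symNorm_gradPos_card_le {ω : Configuration X} (hω : ω.count Set.univ ≠ ⊤) {f b : ℕ → ℝ}
    (hb : ∀ n, 0 ≤ b n) (hup : ∀ n, f n - f (n + 1) ≤ b n)
    (hdown : ∀ n, f (n + 1) - f n ≤ b (n + 1)) :
    symNorm σ ∞ ω (gradPos (fun η => f (card η)) ω) ≤ ENNReal.ofReal (b (card ω)) := by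
  refine symNorm_top_le fun x => ?_
  rw [gradPos, grad_eq_sub_flip, abs_of_nonneg (le_max_left _ _)]
  refine max_le (hb _) ?_
  rcases card_flip hω x with h | h
  · exact h ▸ hup _
  · exact h ▸ hdown _

theorem symNorm_gradNeg_card_le {ω : Configuration X} (hω : ω.count Set.univ ≠ ⊤) {f b : ℕ → ℝ}
    (hb : ∀ n, 0 ≤ b n) (hup : ∀ n, f (n + 1) - f n ≤ b n)
    (hdown : ∀ n, f n - f (n + 1) ≤ b (n + 1)) :
    symNorm σ ∞ ω (gradNeg (fun η => f (card η)) ω) ≤ ENNReal.ofReal (b (card ω)) := by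
  rw [gradNeg_eq_gradPos_neg]
  exact symNorm_gradPos_card_le (f := fun n => -f n) hω hb (fun n => by linarith [hup n])
    fun n => by linarith [hdown n]

theorem measurable_card : Measurable (card (X := X)) :=
  (Measurable.of_discrete (f := ENat.toNat)).comp (measurable_count .univ)

theorem IsPoissonMeasure.lintegral_count_univ (hπ : IsPoissonMeasure σ π) (f : ℕ∞ → ℝ≥0∞) :
    ∫⁻ ω, f (ω.count Set.univ) ∂π = ∫⁻ n, f n ∂poissonMeasure (σ Set.univ).toNNReal := by
  have h := hπ.lintegral_counts (c := fun _ : X => (0 : Fin 1)) measurable_const fun v => f (v 0)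
  simp only [counts, Set.preimage_const_of_mem (Set.mem_singleton (0 : Fin 1))] at h
  rw [h]
  refine ((measurePreserving_eval (fun i : Fin 1 =>
    poissonMeasure (σ ((fun _ => 0) ⁻¹' {i})).toNNReal) 0).lintegral_comp
    (f := fun n : ℕ => f n) .of_discrete).trans ?_
  rw [Set.preimage_const_of_mem (Set.mem_singleton (0 : Fin 1))]

theorem IsPoissonMeasure.lintegral_card (hπ : IsPoissonMeasure σ π) (f : ℕ → ℝ≥0∞) :
    ∫⁻ ω, f (card ω) ∂π = ∫⁻ n, f n ∂poissonMeasure (σ Set.univ).toNNReal := by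
  simpa [card] using hπ.lintegral_count_univ fun v => f v.toNat

theorem IsPoissonMeasure.ae_count_univ_ne_top (hπ : IsPoissonMeasure σ π) :
    ∀ᵐ ω ∂π, ω.count Set.univ ≠ ⊤ := by
  have htop : MeasurableSet {ω : Configuration X | ω.count Set.univ = ⊤} :=
    measurable_count .univ (measurableSet_singleton ⊤)
  simp only [ae_iff, not_not]
  calc π {ω | ω.count Set.univ = ⊤}
      = ∫⁻ ω, ({⊤} : Set ℕ∞).indicator 1 (ω.count Set.univ) ∂π :=
        (lintegral_indicator_one htop).symm
    _ = ∫⁻ n : ℕ, ({⊤} : Set ℕ∞).indicator 1 (n : ℕ∞) ∂poissonMeasure (σ Set.univ).toNNReal :=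
        hπ.lintegral_count_univ _
    _ = 0 := by simp

theorem IsPoissonMeasure.map_card (hπ : IsPoissonMeasure σ π) :
    π.map card = poissonMeasure (σ Set.univ).toNNReal := by
  ext S hS
  rw [← lintegral_indicator_one hS, ← lintegral_indicator_one hS,
    lintegral_map .of_discrete measurable_card, hπ.lintegral_card]

theorem IsPoissonMeasure.evariance_card [IsFiniteMeasure σ] (hπ : IsPoissonMeasure σ π) :
    evariance (fun ω => (card ω : ℝ)) π = σ Set.univ := by
  have hmean : ∫ ω, (card ω : ℝ) ∂π = (σ Set.univ).toNNReal := by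
    rw [← integral_natCast_poissonMeasure, ← hπ.map_card,
      integral_map measurable_card.aemeasurable .of_discrete]
  rw [evariance, hmean, hπ.lintegral_card fun n => ‖(n : ℝ) - (σ Set.univ).toNNReal‖ₑ ^ 2,
    lintegral_enorm_sub_sq_poissonMeasure]
  simp

theorem IsPoissonMeasure.memLp_card (hπ : IsPoissonMeasure σ π) :
    MemLp (fun ω => (card ω : ℝ)) 2 π :=
  (hπ.map_card ▸ memLp_natCast_poissonMeasure _).comp_of_map measurable_card.aemeasurable

end Card

section PoincareConst

variable {X : Type*} [TopologicalSpace X] [MeasurableSpace X] {σ : Measure X}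
  [NullSingletonClass σ]

theorem ae_enorm_sub_add_le_symNorm (F : Configuration X → ℝ) (ω : Configuration X) :
    ∀ᵐ x ∂σ, ‖F ω - F (ω.add x)‖ₑ ≤ symNorm σ ∞ ω (grad F ω) := by
  have h := ae_le_eLpNormEssSup (f := grad F ω) (μ := (2⁻¹ : ℝ≥0∞) • (σ + ω.toMeasure))
  rw [Measure.ae_ennreal_smul_measure_iff (by simp), ae_add_measure_iff] at h
  filter_upwards [h.1, ω.2.1.ae_notMem σ] with x hx hxω
  rwa [grad, if_neg hxω] at hx

variable [MeasurableSingletonClass X] [IsFiniteMeasure σ] {π : Measure (Configuration X)}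

theorem IsPoissonMeasure.evariance_le_lintegral_symNorm (hπ : IsPoissonMeasure σ π)
    {F : Configuration X → ℝ} (hF : Measurable F) (hF2 : MemLp F 2 π) :
    evariance F π ≤ σ Set.univ * ∫⁻ ω, symNorm σ ∞ ω (grad F ω) ^ 2 ∂π :=
  calc evariance F π
      ≤ ∫⁻ ω, ∫⁻ x, ‖F ω - F (ω.add x)‖ₑ ^ 2 ∂σ ∂π := hπ.evariance_le hF hF2
    _ ≤ ∫⁻ ω, ∫⁻ _, symNorm σ ∞ ω (grad F ω) ^ 2 ∂σ ∂π := by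
        refine lintegral_mono fun ω => lintegral_mono_ae ?_
        filter_upwards [ae_enorm_sub_add_le_symNorm F ω] with x hx
        gcongr
    _ = _ := by
        simp only [lintegral_const]
        rw [lintegral_mul_const' _ _ (measure_ne_top _ _), mul_comm]

theorem IsPoissonMeasure.poincareConst_eq (hπ : IsPoissonMeasure σ π) :
    poincareConst σ π ∞ = (σ Set.univ)⁻¹ := by
  have := hπ.isProbabilityMeasure
  refine le_antisymm ?_ (le_iInf₂ fun F hF => le_iInf₂ fun hF2 hvar => ?_)
  · rcases eq_or_ne (σ Set.univ) 0 with h0 | h0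
    · simp [h0]
    refine iInf₂_le_of_le (fun ω => (card ω : ℝ)) (measurable_from_nat.comp measurable_card)
      (iInf₂_le_of_le hπ.memLp_card (hπ.evariance_card ▸ h0) ?_)
    rw [hπ.evariance_card, ← one_div]
    gcongr
    calc ∫⁻ ω, symNorm σ ∞ ω (grad (fun η => (card η : ℝ)) ω) ^ 2 ∂π
        ≤ ∫⁻ _, 1 ∂π := by
          refine lintegral_mono_ae ?_
          filter_upwards [hπ.ae_count_univ_ne_top] with ω hω
          exact pow_le_one' (symNorm_grad_card_le hω) 2
      _ = 1 := by simp
  · rw [ENNReal.le_div_iff_mul_le (.inl hvar) (.inl hF2.evariance_ne_top), mul_comm,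
      ← div_eq_mul_inv]
    exact ENNReal.div_le_of_le_mul' (hπ.evariance_le_lintegral_symNorm hF hF2)

end PoincareConst

/-! ### Upper bounds -/

theorem exists_measure_Ioi_lt_half {μ : Measure ℕ} [IsProbabilityMeasure μ]
    (hμ : ∀ n, μ {n} ≠ 0) : ∃ m : ℕ, μ (Set.Ioi m) < 2⁻¹ ∧ μ {n | n + 1 < m} < 2⁻¹ := by
  classical
  have hex : ∃ m : ℕ, μ (Set.Ioi m) < 2⁻¹ := by
    have h := tendsto_measure_iInter_atTop (μ := μ) (s := fun m : ℕ => Set.Ioi m)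
      (fun _ => MeasurableSet.of_discrete.nullMeasurableSet) (fun _ _ h => Set.Ioi_subset_Ioi h)
      ⟨0, measure_ne_top _ _⟩
    have hempty : ⋂ m : ℕ, Set.Ioi m = ∅ := by
      ext n
      simpa using ⟨n, le_rfl⟩
    rw [hempty, measure_empty] at h
    exact (h.eventually_lt_const (by simp)).exists
  refine ⟨Nat.find hex, Nat.find_spec hex, ?_⟩
  rcases hm : Nat.find hex with - | k
  · simp
  have hk : 2⁻¹ ≤ μ (Set.Ioi k) := not_lt.1 (Nat.find_min hex (hm ▸ k.lt_succ_self))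
  by_contra! hlt
  simp only [Nat.add_lt_add_iff_right] at hlt
  have hdisj : μ (Set.Iio k) + μ {k} + μ (Set.Ioi k) = 1 := by
    rw [← measure_union (by simp) .of_discrete, Set.Iio_union_right,
      ← measure_union (Set.Iic_disjoint_Ioi le_rfl) .of_discrete, Set.Iic_union_Ioi, measure_univ]
  refine (ENNReal.lt_add_right ENNReal.one_ne_top (hμ k)).not_ge ?_
  calc 1 + μ {k} = 2⁻¹ + μ {k} + 2⁻¹ := by rw [add_right_comm, ENNReal.inv_two_add_inv_two]
    _ ≤ μ (Set.Iio k) + μ {k} + μ (Set.Ioi k) := add_le_add (add_le_add_left hlt _) hk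
    _ = 1 := hdisj

theorem poissonMeasure_singleton_ne_zero {r : ℝ≥0} (hr : r ≠ 0) (n : ℕ) :
    poissonMeasure r {n} ≠ 0 := by
  have h := poissonMeasure_real_singleton_pos n (pos_iff_ne_zero.2 hr)
  exact fun h0 => h.ne' (by simp only [Measure.real, h0, ENNReal.toReal_zero])

theorem poissonMeasure_Ioi_zero_lt_half {r : ℝ≥0} (hr : r < Real.log 2) :
    poissonMeasure r (Set.Ioi 0) < 2⁻¹ := by
  have hcompl : Set.Ioi 0 = ({0} : Set ℕ)ᶜ := by
    ext n
    simp [Nat.pos_iff_ne_zero]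
  have hhalf : (2 : ℝ)⁻¹ < Real.exp (-r) := by
    rw [← Real.exp_log two_pos, ← Real.exp_neg]
    gcongr
  rw [hcompl, ← ENNReal.one_sub_inv_two]
  refine prob_compl_lt_one_sub_of_lt_prob ?_ .of_discrete
  rw [← ofReal_measureReal, poissonMeasure_real_singleton]
  simpa using (ENNReal.ofReal_lt_ofReal_iff (Real.exp_pos _)).2 hhalf

/-- The distance of `n` to the pair `{m - 1, m}`, for a median `m`. The test functions for the upper
bounds are the restrictions of `medianDist m ^ 2 + medianDist m` to either side of this pair; their
increments are linear in `medianDist m`. -/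
def medianDist (m n : ℕ) : ℝ := |(n : ℝ) - m + 1 / 2| - 1 / 2

theorem medianDist_eq_tsub_add_tsub (m n : ℕ) :
    medianDist m n = (n - m : ℕ) + (m - 1 - n : ℕ) := by
  rcases le_or_gt m n with h | h
  · have hmn : (m : ℝ) ≤ n := by exact_mod_cast h
    rw [medianDist, abs_of_nonneg (by linarith), Nat.cast_sub h,
      Nat.sub_eq_zero_of_le (by lia : m - 1 ≤ n), Nat.cast_zero]
    ring
  · have hnm : (n : ℝ) + 1 ≤ m := by exact_mod_cast h
    rw [medianDist, abs_of_nonpos (by linarith), Nat.sub_eq_zero_of_le h.le, Nat.sub_sub,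
      add_comm 1 n, Nat.cast_sub h]
    push_cast
    ring

theorem medianDist_add_one (m n : ℕ) :
    medianDist m n + 1 = (n + 1 - m : ℕ) + (m - n : ℕ) := by
  rw [medianDist_eq_tsub_add_tsub]
  norm_cast
  lia

theorem medianDist_nonneg (m n : ℕ) : 0 ≤ medianDist m n := by
  rw [medianDist_eq_tsub_add_tsub]
  positivity

theorem medianDist_sq_add (m n : ℕ) :
    medianDist m n ^ 2 + medianDist m n = ((n : ℝ) - (m - 1 / 2)) ^ 2 - 1 / 4 := by
  rw [medianDist]
  linear_combination sq_abs ((n : ℝ) - m + 1 / 2)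

theorem medianDist_sq_add_eq_add (m n : ℕ) :
    medianDist m n ^ 2 + medianDist m n =
      ((n - m : ℕ) * ((n - m : ℕ) + 1)) + ((m - 1 - n : ℕ) * ((m - 1 - n : ℕ) + 1)) := by
  have hmul : ((n - m : ℕ) : ℝ) * (m - 1 - n : ℕ) = 0 := by
    norm_cast
    rcases le_total m n with h | h
    · rw [Nat.sub_eq_zero_of_le (by lia : m - 1 ≤ n), mul_zero]
    · rw [Nat.sub_eq_zero_of_le h, zero_mul]
  rw [medianDist_eq_tsub_add_tsub]
  linear_combination 2 * hmul

theorem sq_integral_le_integral_sq {α : Type*} [MeasurableSpace α] {μ : Measure α}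
    [IsProbabilityMeasure μ] {f : α → ℝ} (hf : MemLp f 2 μ) :
    (∫ x, f x ∂μ) ^ 2 ≤ ∫ x, f x ^ 2 ∂μ := by
  have := variance_eq_sub hf ▸ variance_nonneg f μ
  simpa using this

section MedianDist

variable (r : ℝ≥0) (m : ℕ)

theorem memLp_medianDist : MemLp (medianDist m) 2 (poissonMeasure r) :=
  (((memLp_natCast_poissonMeasure r).sub (memLp_const _)).add (memLp_const _)).abs.sub
    (memLp_const _)

theorem integrable_medianDist : Integrable (medianDist m) (poissonMeasure r) :=
  (memLp_medianDist r m).integrable one_le_two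

theorem integrable_medianDist_sq_add :
    Integrable (fun n => medianDist m n ^ 2 + medianDist m n) (poissonMeasure r) :=
  (memLp_medianDist r m).integrable_sq.add (integrable_medianDist r m)

theorem le_integral_medianDist_sq_add :
    (r : ℝ) - 1 / 4 ≤ ∫ n, (medianDist m n ^ 2 + medianDist m n) ∂poissonMeasure r := by
  have h : Integrable (fun n : ℕ => ((n : ℝ) - (m - 1 / 2)) ^ 2) (poissonMeasure r) :=
    ((memLp_natCast_poissonMeasure r).sub (memLp_const _)).integrable_sq
  simp only [medianDist_sq_add]
  rw [integral_sub h (integrable_const _), integral_sub_sq_poissonMeasure, integral_const,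
    probReal_univ, one_smul]
  gcongr
  exact le_add_of_nonneg_right (sq_nonneg _)

theorem sq_add_integral_medianDist_le :
    (∫ n, medianDist m n ∂poissonMeasure r) ^ 2 + ∫ n, medianDist m n ∂poissonMeasure r ≤
      ∫ n, (medianDist m n ^ 2 + medianDist m n) ∂poissonMeasure r := by
  rw [integral_add (memLp_medianDist r m).integrable_sq (integrable_medianDist r m)]
  gcongr
  exact sq_integral_le_integral_sq (memLp_medianDist r m)

variable {r}

theorem integral_medianDist_pos (hr : r ≠ 0) : 0 < ∫ n, medianDist m n ∂poissonMeasure r := by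
  rw [integral_pos_iff_support_of_nonneg (medianDist_nonneg m) (integrable_medianDist r m)]
  refine (pos_iff_ne_zero.2 (poissonMeasure_singleton_ne_zero hr (m + 1))).trans_le
    (measure_mono ?_)
  simp only [Set.singleton_subset_iff, Function.mem_support, medianDist_eq_tsub_add_tsub]
  norm_cast
  lia

variable {m}

theorem exists_toReal_mul_le_of_mul_lintegral_medianDist_le (hr : r ≠ 0) {a : ℝ≥0∞} {c : ℝ}
    (hc : 0 ≤ c)
    (h : a * ∫⁻ n, ENNReal.ofReal (medianDist m n ^ 2 + medianDist m n) ∂poissonMeasure r ≤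
      ∫⁻ n, ENNReal.ofReal (2 * medianDist m n + c) ∂poissonMeasure r) :
    a ≠ ⊤ ∧ ∃ s : ℝ, 0 < s ∧ a.toReal * (s ^ 2 + s) ≤ 2 * s + c ∧
      a.toReal * (r - 1 / 4) ≤ 2 * s + c := by
  have hs := integral_medianDist_pos m hr
  have hsq := sq_add_integral_medianDist_le r m
  have hd := medianDist_nonneg m
  have hlin : Integrable (fun n => 2 * medianDist m n + c) (poissonMeasure r) :=
    ((integrable_medianDist r m).const_mul 2).add (integrable_const c)
  rw [← ofReal_integral_eq_lintegral_ofReal (integrable_medianDist_sq_add r m)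
      (.of_forall fun n => add_nonneg (sq_nonneg _) (hd n)),
    ← ofReal_integral_eq_lintegral_ofReal hlin
      (.of_forall fun n => add_nonneg (mul_nonneg zero_le_two (hd n)) hc),
    integral_add ((integrable_medianDist r m).const_mul 2) (integrable_const c),
    integral_const_mul, integral_const, probReal_univ, one_smul] at h
  have hpos : 0 < ∫ n, (medianDist m n ^ 2 + medianDist m n) ∂poissonMeasure r :=
    (by positivity : (0 : ℝ) < _).trans_le hsq
  have ha : a ≠ ⊤ := by
    rintro rfl
    rw [ENNReal.top_mul (ENNReal.ofReal_pos.2 hpos).ne'] at h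
    exact ENNReal.ofReal_ne_top (top_le_iff.1 h)
  have hreal := ENNReal.toReal_mono ENNReal.ofReal_ne_top h
  rw [ENNReal.toReal_mul, ENNReal.toReal_ofReal hpos.le, ENNReal.toReal_ofReal (by positivity)]
    at hreal
  refine ⟨ha, _, hs, le_trans ?_ hreal, le_trans ?_ hreal⟩
  · gcongr
  · gcongr
    exact le_integral_medianDist_sq_add r m

end MedianDist

theorem natCast_mul_succ_sub_pred (k : ℕ) :
    (k : ℝ) * (k + 1) - (k - 1 : ℕ) * ((k - 1 : ℕ) + 1) = 2 * k := by
  cases k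
  · simp
  · push_cast [Nat.add_sub_cancel]
    ring

section Bounds

variable {X : Type*} [TopologicalSpace X] [MeasurableSpace X] {σ : Measure X}
  {π : Measure (Configuration X)} {N : (Configuration X → ℝ) → Configuration X → ℝ≥0∞}

theorem IsPoissonMeasure.isoConst_mul_lintegral_le (hπ : IsPoissonMeasure σ π)
    (hN : IsCoareaNorm N) {f b : ℕ → ℝ} (h0 : ∀ n, 0 ≤ f n)
    (hf : poissonMeasure (σ Set.univ).toNNReal {n | 0 < f n} < 2⁻¹)
    (hb : ∀ ω : Configuration X, ω.count Set.univ ≠ ⊤ →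
      N (fun η => f (card η)) ω ≤ ENNReal.ofReal (b (card ω))) :
    isoConst π N * ∫⁻ n, ENNReal.ofReal (f n) ∂poissonMeasure (σ Set.univ).toNNReal ≤
      ∫⁻ n, ENNReal.ofReal (b n) ∂poissonMeasure (σ Set.univ).toNNReal := by
  have := hπ.isProbabilityMeasure
  rw [← hπ.map_card, Measure.map_apply measurable_card .of_discrete] at hf
  rw [← hπ.lintegral_card fun n => ENNReal.ofReal (f n),
    ← hπ.lintegral_card fun n => ENNReal.ofReal (b n),
    ← excess_eq_lintegral (fun ω => h0 (card ω)) hf]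
  refine (hN.isoConst_mul_excess_le (measurable_from_nat.comp measurable_card)).trans
    (lintegral_mono_ae ?_)
  filter_upwards [hπ.ae_count_univ_ne_top] with ω hω using hb ω hω

theorem IsPoissonMeasure.isoConst_mul_lintegral_medianDist_le (hπ : IsPoissonMeasure σ π)
    (hN : IsCoareaNorm N) {m : ℕ}
    (hright : poissonMeasure (σ Set.univ).toNNReal (Set.Ioi m) < 2⁻¹)
    (hleft : poissonMeasure (σ Set.univ).toNNReal {n | n + 1 < m} < 2⁻¹)
    {b₁ b₂ : ℕ → ℝ} (h₁ : ∀ n, 0 ≤ b₁ n) (h₂ : ∀ n, 0 ≤ b₂ n)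
    (hb₁ : ∀ ω : Configuration X, ω.count Set.univ ≠ ⊤ →
      N (fun η => (card η - m : ℕ) * ((card η - m : ℕ) + 1)) ω ≤ ENNReal.ofReal (b₁ (card ω)))
    (hb₂ : ∀ ω : Configuration X, ω.count Set.univ ≠ ⊤ →
      N (fun η => (m - 1 - card η : ℕ) * ((m - 1 - card η : ℕ) + 1)) ω ≤
        ENNReal.ofReal (b₂ (card ω))) :
    isoConst π N * ∫⁻ n, ENNReal.ofReal (medianDist m n ^ 2 + medianDist m n)
        ∂poissonMeasure (σ Set.univ).toNNReal ≤
      ∫⁻ n, ENNReal.ofReal (b₁ n + b₂ n) ∂poissonMeasure (σ Set.univ).toNNReal := by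
  simp only [medianDist_sq_add_eq_add]
  rw [lintegral_congr fun n => ENNReal.ofReal_add (by positivity) (by positivity),
    lintegral_congr fun n => ENNReal.ofReal_add (h₁ n) (h₂ n),
    lintegral_add_left .of_discrete, lintegral_add_left .of_discrete, mul_add]
  refine add_le_add
    (hπ.isoConst_mul_lintegral_le (f := fun n => (n - m : ℕ) * ((n - m : ℕ) + 1)) hN
      (fun n => by positivity) ((measure_mono fun n hn => ?_).trans_lt hright) hb₁)
    (hπ.isoConst_mul_lintegral_le (f := fun n => (m - 1 - n : ℕ) * ((m - 1 - n : ℕ) + 1)) hN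
      (fun n => by positivity) ((measure_mono fun n hn => ?_).trans_lt hleft) hb₂)
  · by_contra h
    simp [Nat.sub_eq_zero_of_le (not_lt.1 h)] at hn
  · by_contra h
    simp [Nat.sub_eq_zero_of_le (by simp at h; lia : m - 1 ≤ n)] at hn

theorem IsPoissonMeasure.hPos_mul_lintegral_medianDist_le (hπ : IsPoissonMeasure σ π) {m : ℕ}
    (hright : poissonMeasure (σ Set.univ).toNNReal (Set.Ioi m) < 2⁻¹)
    (hleft : poissonMeasure (σ Set.univ).toNNReal {n | n + 1 < m} < 2⁻¹) :
    hPos σ π ∞ * ∫⁻ n, ENNReal.ofReal (medianDist m n ^ 2 + medianDist m n)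
        ∂poissonMeasure (σ Set.univ).toNNReal ≤
      ∫⁻ n, ENNReal.ofReal (2 * medianDist m n) ∂poissonMeasure (σ Set.univ).toNNReal := by
  have hsum (n : ℕ) : 2 * medianDist m n = 2 * (n - m : ℕ) + 2 * (m - 1 - n : ℕ) := by
    rw [medianDist_eq_tsub_add_tsub]
    ring
  simp only [hsum]
  refine hπ.isoConst_mul_lintegral_medianDist_le (isCoareaNorm_gradPos σ) hright hleft
    (b₁ := fun n => 2 * (n - m : ℕ)) (b₂ := fun n => 2 * (m - 1 - n : ℕ))
    (fun n => by positivity) (fun n => by positivity)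
    (fun ω hω => symNorm_gradPos_card_le hω (f := fun n => (n - m : ℕ) * ((n - m : ℕ) + 1))
      (b := fun n => 2 * (n - m : ℕ)) (fun n => by positivity) (fun n => ?_) (fun n => ?_))
    (fun ω hω => symNorm_gradPos_card_le hω
      (f := fun n => (m - 1 - n : ℕ) * ((m - 1 - n : ℕ) + 1)) (b := fun n => 2 * (m - 1 - n : ℕ))
      (fun n => by positivity) (fun n => ?_) (fun n => ?_))
  · refine (sub_nonpos.2 ?_).trans (by positivity)
    gcongr <;> lia
  · have hpred : n + 1 - m - 1 = n - m := by lia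
    exact hpred ▸ (natCast_mul_succ_sub_pred (n + 1 - m)).le
  · exact (natCast_mul_succ_sub_pred (m - 1 - n)).le
  · refine (sub_nonpos.2 ?_).trans (by positivity)
    gcongr <;> lia

theorem IsPoissonMeasure.hNeg_mul_lintegral_medianDist_le (hπ : IsPoissonMeasure σ π) {m : ℕ}
    (hright : poissonMeasure (σ Set.univ).toNNReal (Set.Ioi m) < 2⁻¹)
    (hleft : poissonMeasure (σ Set.univ).toNNReal {n | n + 1 < m} < 2⁻¹) :
    hNeg σ π ∞ * ∫⁻ n, ENNReal.ofReal (medianDist m n ^ 2 + medianDist m n)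
        ∂poissonMeasure (σ Set.univ).toNNReal ≤
      ∫⁻ n, ENNReal.ofReal (2 * medianDist m n + 2) ∂poissonMeasure (σ Set.univ).toNNReal := by
  have hsum (n : ℕ) : 2 * medianDist m n + 2 = 2 * (n + 1 - m : ℕ) + 2 * (m - n : ℕ) := by
    linear_combination 2 * medianDist_add_one m n
  simp only [hsum]
  refine hπ.isoConst_mul_lintegral_medianDist_le (isCoareaNorm_gradNeg σ) hright hleft
    (b₁ := fun n => 2 * (n + 1 - m : ℕ)) (b₂ := fun n => 2 * (m - n : ℕ))
    (fun n => by positivity) (fun n => by positivity)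
    (fun ω hω => symNorm_gradNeg_card_le hω (f := fun n => (n - m : ℕ) * ((n - m : ℕ) + 1))
      (b := fun n => 2 * (n + 1 - m : ℕ)) (fun n => by positivity) (fun n => ?_) (fun n => ?_))
    (fun ω hω => symNorm_gradNeg_card_le hω
      (f := fun n => (m - 1 - n : ℕ) * ((m - 1 - n : ℕ) + 1)) (b := fun n => 2 * (m - n : ℕ))
      (fun n => by positivity) (fun n => ?_) (fun n => ?_))
  · have hpred : n + 1 - m - 1 = n - m := by lia
    exact hpred ▸ (natCast_mul_succ_sub_pred (n + 1 - m)).le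
  · refine (sub_nonpos.2 ?_).trans (by positivity)
    gcongr <;> lia
  · refine (sub_nonpos.2 ?_).trans (by positivity)
    gcongr <;> lia
  · rw [Nat.sub_add_eq m, Nat.sub_right_comm m n 1]
    exact (natCast_mul_succ_sub_pred (m - 1 - n)).le

theorem lintegral_ofReal_indicator_one {α : Type*} [MeasurableSpace α] {μ : Measure α} {S : Set α}
    (hS : MeasurableSet S) : ∫⁻ x, ENNReal.ofReal (S.indicator 1 x) ∂μ = μ S := by
  rw [← lintegral_indicator_one hS]
  refine lintegral_congr fun x => ?_
  by_cases hx : x ∈ S <;> simp [hx]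

theorem IsPoissonMeasure.hNeg_mul_le_one (hπ : IsPoissonMeasure σ π) (hσ : σ Set.univ ≠ ⊤)
    (hlog : (σ Set.univ).toReal < Real.log 2) : hNeg σ π ∞ * σ Set.univ ≤ 1 := by
  obtain ⟨r, hr⟩ : ∃ r : ℝ≥0, r = σ Set.univ := ⟨_, ENNReal.coe_toNNReal hσ⟩
  rw [← hr] at hlog ⊢
  rcases eq_or_ne r 0 with rfl | hr0
  · simp
  have hbound : hNeg σ π ∞ * poissonMeasure r (Set.Ioi 0) ≤ poissonMeasure r {0} := by
    have hsupp : {n : ℕ | 0 < (Set.Ioi 0).indicator (1 : ℕ → ℝ) n} = Set.Ioi 0 := by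
      ext n
      cases n <;> simp
    have h := hπ.isoConst_mul_lintegral_le (isCoareaNorm_gradNeg σ)
      (f := (Set.Ioi 0).indicator 1) (b := Set.indicator {0} 1)
      (Set.indicator_nonneg fun _ _ => zero_le_one)
      (by simpa [← hr, hsupp] using poissonMeasure_Ioi_zero_lt_half hlog)
      fun ω hω => symNorm_gradNeg_card_le hω (Set.indicator_nonneg fun _ _ => zero_le_one)
        (fun n => by cases n <;> simp) (fun n => by cases n <;> simp)
    rwa [← hr, lintegral_ofReal_indicator_one .of_discrete,
      lintegral_ofReal_indicator_one .of_discrete] at h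
  refine (ENNReal.mul_le_mul_iff_left (poissonMeasure_singleton_ne_zero hr0 0)
    (measure_ne_top _ _)).1 ?_
  calc hNeg σ π ∞ * r * poissonMeasure r {0} = hNeg σ π ∞ * poissonMeasure r {1} := by
        rw [mul_assoc, ← natCast_succ_mul_poissonMeasure_singleton, zero_add, Nat.cast_one, one_mul]
    _ ≤ hNeg σ π ∞ * poissonMeasure r (Set.Ioi 0) := by gcongr; simp
    _ ≤ 1 * poissonMeasure r {0} := by rwa [one_mul]

theorem le_two_div_sqrt {a s r : ℝ} (ha : 0 ≤ a) (hs : 0 < s) (hr : 0 < r)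
    (h₁ : a * (s ^ 2 + s) ≤ 2 * s) (h₂ : a * (r - 1 / 4) ≤ 2 * s) : a ≤ 2 / √r := by
  obtain ⟨q, hq, rfl⟩ : ∃ q : ℝ, 0 < q ∧ q ^ 2 = r := ⟨√r, Real.sqrt_pos.2 hr, Real.sq_sqrt hr.le⟩
  have h : a * (s + 1) ≤ 2 := le_of_mul_le_mul_right (by linarith) hs
  rw [Real.sqrt_sq hq.le, le_div_iff₀ hq]
  rcases le_or_gt (q - 1 / 2) s with hqs | hqs
  · calc a * q ≤ a * (s + 1) := by gcongr; linarith
      _ ≤ 2 := h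
  · have hpos : 0 < q - 1 / 2 := hs.trans hqs
    have : a * (q + 1 / 2) ≤ 2 := le_of_mul_le_mul_right (by linarith) hpos
    linarith

theorem le_two_div_mul_one_add_sqrt {a s r : ℝ} (ha : 0 ≤ a) (hs : 0 < s) (hr : Real.log 2 ≤ r)
    (h₁ : a * (s ^ 2 + s) ≤ 2 * s + 2) (h₂ : a * (r - 1 / 4) ≤ 2 * s + 2) :
    a ≤ 2 / r * (1 + √(2 * r)) := by
  have hr' : 0.69 < r := by linarith [Real.log_two_gt_d9]
  obtain ⟨q, hq, rfl⟩ : ∃ q : ℝ, 0 < q ∧ q ^ 2 = r :=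
    ⟨√r, Real.sqrt_pos.2 (by linarith), Real.sq_sqrt (by linarith)⟩
  have hq' : 0.83 < q := lt_of_pow_lt_pow_left₀ 2 hq.le (by linarith)
  have h : a * s ≤ 2 := le_of_mul_le_mul_right (by linarith) (by linarith : 0 < s + 1)
  have hmid : a * (q - 1 / 2) ≤ 2 := by
    rcases le_or_gt (q - 1 / 2) s with hqs | hqs
    · exact (mul_le_mul_of_nonneg_left hqs ha).trans h
    · exact le_of_mul_le_mul_right (by linarith) (by linarith : 0 < q + 1 / 2)
  have hsqrt2 : 1.414 < √2 := Real.lt_sqrt_of_sq_lt (by norm_num)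
  have hsqrt2' : √2 < 1.415 := (Real.sqrt_lt' (by norm_num)).2 (by norm_num)
  have hquad : q ^ 2 ≤ (q - 1 / 2) * (1 + √2 * q) := by nlinarith
  rw [Real.sqrt_mul zero_le_two, Real.sqrt_sq hq.le, div_mul_eq_mul_div,
    le_div_iff₀ (by positivity)]
  calc a * q ^ 2 ≤ a * ((q - 1 / 2) * (1 + √2 * q)) := by gcongr
    _ = a * (q - 1 / 2) * (1 + √2 * q) := by ring
    _ ≤ 2 * (1 + √2 * q) := by gcongr

variable [IsFiniteMeasure σ]

theorem IsPoissonMeasure.hPos_le (hπ : IsPoissonMeasure σ π) :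
    hPos σ π ∞ ≤ 2 / σ Set.univ ^ (1 / 2 : ℝ) := by
  obtain ⟨r, hr⟩ : ∃ r : ℝ≥0, r = σ Set.univ :=
    ⟨_, ENNReal.coe_toNNReal (measure_ne_top σ Set.univ)⟩
  rcases eq_or_ne r 0 with rfl | hr0
  · simp [← hr, ENNReal.div_zero]
  have hrpos : (0 : ℝ) < r := by positivity
  obtain ⟨m, hright, hleft⟩ := exists_measure_Ioi_lt_half (poissonMeasure_singleton_ne_zero hr0)
  have hmul := hπ.hPos_mul_lintegral_medianDist_le (m := m)
  simp only [← hr, ENNReal.toNNReal_coe] at hmul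
  obtain ⟨htop, s, hs, h₁, h₂⟩ :=
    exists_toReal_mul_le_of_mul_lintegral_medianDist_le hr0 le_rfl
      (by simpa only [add_zero] using hmul hright hleft)
  rw [add_zero] at h₁ h₂
  rw [← ENNReal.ofReal_toReal htop, ← hr]
  refine (ENNReal.ofReal_le_ofReal
    (le_two_div_sqrt ENNReal.toReal_nonneg hs hrpos h₁ h₂)).trans_eq ?_
  rw [ENNReal.ofReal_div_of_pos (by positivity), Real.sqrt_eq_rpow,
    ← ENNReal.ofReal_rpow_of_pos hrpos, ENNReal.ofReal_ofNat, ENNReal.ofReal_coe_nnreal]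

theorem IsPoissonMeasure.hNeg_le (hπ : IsPoissonMeasure σ π) :
    hNeg σ π ∞ ≤ 2 / σ Set.univ * (1 + (2 * σ Set.univ) ^ (1 / 2 : ℝ)) := by
  rcases lt_or_ge (σ Set.univ).toReal (Real.log 2) with hlog | hlog
  · calc hNeg σ π ∞ ≤ 1 / σ Set.univ :=
        (ENNReal.le_div_iff_mul_le (.inr one_ne_zero) (.inr ENNReal.one_ne_top)).2
          (hπ.hNeg_mul_le_one (measure_ne_top _ _) hlog)
      _ ≤ 2 / σ Set.univ * 1 := by rw [mul_one]; gcongr; exact one_le_two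
      _ ≤ _ := by gcongr; exact le_self_add
  obtain ⟨r, hr⟩ : ∃ r : ℝ≥0, r = σ Set.univ :=
    ⟨_, ENNReal.coe_toNNReal (measure_ne_top σ Set.univ)⟩
  rw [← hr, ENNReal.coe_toReal] at hlog
  have hrpos : (0 : ℝ) < r := (Real.log_pos one_lt_two).trans_le hlog
  have hr0 : r ≠ 0 := (NNReal.coe_pos.1 hrpos).ne'
  obtain ⟨m, hright, hleft⟩ := exists_measure_Ioi_lt_half (poissonMeasure_singleton_ne_zero hr0)
  have hmul := hπ.hNeg_mul_lintegral_medianDist_le (m := m)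
  simp only [← hr, ENNReal.toNNReal_coe] at hmul
  obtain ⟨htop, s, hs, h₁, h₂⟩ :=
    exists_toReal_mul_le_of_mul_lintegral_medianDist_le hr0 zero_le_two (hmul hright hleft)
  rw [← ENNReal.ofReal_toReal htop, ← hr]
  refine (ENNReal.ofReal_le_ofReal
    (le_two_div_mul_one_add_sqrt ENNReal.toReal_nonneg hs hlog h₁ h₂)).trans_eq ?_
  rw [ENNReal.ofReal_mul (by positivity), ENNReal.ofReal_div_of_pos hrpos,
    ENNReal.ofReal_add zero_le_one (by positivity), Real.sqrt_eq_rpow,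
    ← ENNReal.ofReal_rpow_of_pos (by positivity), ENNReal.ofReal_mul zero_le_two,
    ENNReal.ofReal_ofNat, ENNReal.ofReal_one, ENNReal.ofReal_coe_nnreal]

end Bounds

end PoissonSpace

end

theorem mainTheorem8_general {X : Type*} [TopologicalSpace X] [MeasurableSpace X]
    [MeasurableSingletonClass X] (σ : Measure X) [IsFiniteMeasure σ] [NullSingletonClass σ]
    (π : Measure (PoissonSpace.Configuration X)) (hπ : PoissonSpace.IsPoissonMeasure σ π) :
    (PoissonSpace.kPos σ π ∞ = PoissonSpace.hPos σ π ∞ ∧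
      PoissonSpace.hPos σ π ∞ ≤ 2 * PoissonSpace.poincareConst σ π ∞ ^ (1 / 2 : ℝ) ∧
      2 * PoissonSpace.poincareConst σ π ∞ ^ (1 / 2 : ℝ) = 2 / σ Set.univ ^ (1 / 2 : ℝ)) ∧
    (PoissonSpace.kNeg σ π ∞ = PoissonSpace.hNeg σ π ∞ ∧
      PoissonSpace.hNeg σ π ∞ ≤
        2 / σ Set.univ * (1 + (2 * σ Set.univ) ^ (1 / 2 : ℝ))) := by
  have := hπ.isProbabilityMeasure
  have hlam : 2 * PoissonSpace.poincareConst σ π ∞ ^ (1 / 2 : ℝ) =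
      2 / σ Set.univ ^ (1 / 2 : ℝ) := by
    rw [hπ.poincareConst_eq, ENNReal.inv_rpow, ← div_eq_mul_inv]
  exact ⟨⟨PoissonSpace.kPos_eq_hPos, hπ.hPos_le.trans_eq hlam.symm, hlam⟩,
    PoissonSpace.kNeg_eq_hNeg, hπ.hNeg_le⟩

theorem mainTheorem8 {X : Type*} [MetricSpace X] [MeasurableSpace X] [BorelSpace X]
    (σ : Measure X) [IsFiniteMeasure σ] [NullSingletonClass σ]
    (π : Measure (PoissonSpace.Configuration X)) (hπ : PoissonSpace.IsPoissonMeasure σ π) :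
    (PoissonSpace.kPos σ π ∞ = PoissonSpace.hPos σ π ∞ ∧
      PoissonSpace.hPos σ π ∞ ≤ 2 * PoissonSpace.poincareConst σ π ∞ ^ (1 / 2 : ℝ) ∧
      2 * PoissonSpace.poincareConst σ π ∞ ^ (1 / 2 : ℝ) = 2 / σ Set.univ ^ (1 / 2 : ℝ)) ∧
    (PoissonSpace.kNeg σ π ∞ = PoissonSpace.hNeg σ π ∞ ∧
      PoissonSpace.hNeg σ π ∞ ≤
        2 / σ Set.univ * (1 + (2 * σ Set.univ) ^ (1 / 2 : ℝ))) :=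
  mainTheorem8_general σ π hπ
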